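/- A point of $\mathbb R^3$ is integer if its coordinates are integers. Let $l_1,l_2,l_3$ be an unordered triple of linearly independent straight lines through the origin of $\mathbb R^3$. The three planes spanned by pairs of these lines cut $\mathbb R^3$ into $8$ open orthants. The sail of an orthant is the boundary of the convex hull of all nonzero integer points of its closure, and the set of the $8$ sails is the two-dimensional continued fraction (in the sense of Klein) given by the triple. A face of a sail is a set $F$ that is the intersection of the sail with a plane and that, for some $k$, is contained in a $k$-dimensional plane and is homeomorphic to the $k$-dimensional disc. Let $CF_2$ be the set of all two-dimensional continued fractions and $FCF_2$ the set of ordered triples of independent lines (framed continued fractions), with the projection $p:FCF_2\to CF_2$. For an ordered triple of lines meeting the plane $\pi=\{z=1\}$ let $A_i=(x_i,y_i,1)$ be the intersection points, and let $S_\pi(A_1A_2A_3)$ be the oriented Euclidean area of the triangle. Let $\mu$ be the (Möbius) measure on $FCF_2$ which in these coordinates is $$\frac{dx_1\,dy_1\,dx_2\,dy_2\,dx_3\,dy_3}{|S_\pi(A_1A_2A_3)|^{3}}$$ and for which the triples with a line parallel to $\pi$ form a null set; set $\mu_2=\frac1{3!}\,p_*\mu$. For a polytope $F\subset\mathbb R^3$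 with integer vertices let $CF_2(F)$ be the set of continued fractions having a sail with $F$ as a face. The relative frequency of $F$ is $\mu_2(CF_2(F))\in[0,\infty]$. Two sets have the same integer-affine type if an affine transformation of $\mathbb R^3$ preserving $\mathbb Z^3$ takes one to the other. The integer distance from the origin to an integer plane $P$ (of any dimension) not containing the origin is $\ell/\ell_0$, where $\ell$ is the Euclidean distance from the origin to $P$ and $\ell_0$ is the minimal nonzero Euclidean distance to $P$ from integer points of the linear span of $P$. Theorem. Let $F_1,F_2\subset\mathbb R^3$ be polytopes with integer vertices, each of which is a face of some two-dimensional continued fraction. Suppose that $F_1$ and $F_2$ have the same integer-affine type, that the affine hull of $F_1$ is at integer distance $1$ from the origin, and that the affine hull of $F_2$ is at integer distance $2$ from the origin. Then $\mu_2(CF_2(F_1))=\mu_2(CF_2(F_2))$. -/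

import Mathlib

open MeasureTheory
open scoped LinearAlgebra.Projectivization ENNReal Nat

noncomputable section

namespace KleinCF

/-- The Euclidean space `ℝⁿ⁺¹` in which `n`-dimensional continued fractions live. -/
abbrev E (n : ℕ) : Type := EuclideanSpace ℝ (Fin (n + 1))

/-! ### Integer geometry -/

/-- The lattice of integer points of `ℝⁿ⁺¹`. -/
def integerPoints (n : ℕ) : Set (E n) :=
  {x | ∀ i, ∃ m : ℤ, x i = m}

/-- A (convex) polytope with vertices at integer points. -/
def IsIntegerPolytope {n : ℕ} (F : Set (E n)) : Prop :=
  ∃ s : Finset (E n), (s : Set (E n)) ⊆ integerPoints n ∧ F = convexHull ℝ (s : Set (E n))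

/-- Two sets have the same integer-affine type: some affine transformation preserving the integer
lattice takes one to the other. -/
def SameIntegerAffineType {n : ℕ} (F G : Set (E n)) : Prop :=
  ∃ g : E n ≃ᵃ[ℝ] E n, g '' integerPoints n = integerPoints n ∧ g '' F = G

/-- The integer distance from the origin to the plane `P` (meant for integer planes not through
the origin): the ratio of the Euclidean distance from the origin to `P` and the minimal nonzero
Euclidean distance to `P` from integer points of the plane spanned by `P` and the origin. -/
def integerDistance {n : ℕ} (P : AffineSubspace ℝ (E n)) : ℝ :=
  Metric.infDist 0 (P : Set (E n)) /
    sInf {r : ℝ | 0 < r ∧ ∃ x ∈ integerPoints n,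
      x ∈ Submodule.span ℝ (P : Set (E n)) ∧ r = Metric.infDist x (P : Set (E n))}

/-! ### The spaces of framed and unframed continued fractions -/

/-- The Borel σ-algebra of a projective space, as the quotient σ-algebra under `v ↦ [v]`. -/
instance projMeasurableSpace (n : ℕ) : MeasurableSpace (ℙ ℝ (E n)) :=
  MeasurableSpace.map (Projectivization.mk' ℝ) inferInstance

/-- Framed `n`-dimensional continued fractions: ordered collections of `n + 1` independent
straight lines through the origin of `ℝⁿ⁺¹`. -/
def FCF (n : ℕ) : Type :=
  {l : Fin (n + 1) → ℙ ℝ (E n) // Projectivization.Independent l}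

instance (n : ℕ) : MeasurableSpace (FCF n) :=
  inferInstanceAs (MeasurableSpace
    {l : Fin (n + 1) → ℙ ℝ (E n) // Projectivization.Independent l})

/-- Two framed continued fractions are identified when they differ by the order of the lines. -/
def permSetoid (n : ℕ) : Setoid (FCF n) where
  r l l' := ∃ σ : Equiv.Perm (Fin (n + 1)), l'.1 = l.1 ∘ σ
  iseqv :=
    { refl := fun _ => ⟨1, rfl⟩
      symm := by
        rintro l l' ⟨σ, h⟩
        exact ⟨σ⁻¹, by rw [h]; funext i; simp⟩
      trans := by
        rintro l l' l'' ⟨σ, h⟩ ⟨τ, h'⟩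
        exact ⟨σ * τ, by rw [h', h]; rfl⟩ }

/-- `n`-dimensional continued fractions: unordered collections of `n + 1` independent straight
lines; the hyperplanes of the continued fraction are spanned by `n` of the lines. -/
def CF (n : ℕ) : Type := Quotient (permSetoid n)

instance (n : ℕ) : MeasurableSpace (CF n) :=
  inferInstanceAs (MeasurableSpace (Quotient (permSetoid n)))

/-- The natural projection, forgetting the order of the lines. -/
def proj (n : ℕ) : FCF n → CF n := Quotient.mk (permSetoid n)

/-! ### Sails and faces -/

/-- `O` is one of the `2ⁿ⁺¹` open orthants cut out by the hyperplanes spanned by the lines of `l`: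
it consists of the positive combinations of nonzero vectors `v i`, one on every line. -/
def IsOrthant {n : ℕ} (l : FCF n) (O : Set (E n)) : Prop :=
  ∃ v : Fin (n + 1) → E n, (∀ i, v i ≠ 0 ∧ v i ∈ (l.1 i).submodule) ∧
    O = {x | ∃ c : Fin (n + 1) → ℝ, (∀ i, 0 < c i) ∧ x = ∑ i, c i • v i}

/-- The sail of an orthant: the boundary of the convex hull of all integer points of the closure
of the orthant except the origin. -/
def sail {n : ℕ} (O : Set (E n)) : Set (E n) :=
  frontier (convexHull ℝ ((closure O ∩ integerPoints n) \ {0}))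

/-- The continued fraction as a set of sails. -/
def sails {n : ℕ} (c : CF n) : Set (Set (E n)) :=
  {S | ∃ l : FCF n, proj n l = c ∧ ∃ O, IsOrthant l O ∧ S = sail O}

/-- `F` is a `k`-dimensional face of the sail `S`: an intersection of a hyperplane with the sail
that is contained in a `k`-dimensional plane and is homeomorphic to the `k`-dimensional disc. -/
def IsFace {n : ℕ} (k : ℕ) (F S : Set (E n)) : Prop :=
  (∃ H : AffineSubspace ℝ (E n), Module.finrank ℝ H.direction = n ∧ F = (H : Set (E n)) ∩ S) ∧
  (∃ P : AffineSubspace ℝ (E n), Module.finrank ℝ P.direction = k ∧ F ⊆ P) ∧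
  Nonempty (F ≃ₜ Metric.closedBall (0 : EuclideanSpace ℝ (Fin k)) 1)

/-- The set of `n`-dimensional continued fractions that contain `F` as a face. -/
def CFWithFace (n : ℕ) (F : Set (E n)) : Set (CF n) :=
  {c | ∃ S ∈ sails c, ∃ k, IsFace k F S}

/-! ### The Möbius measure

Every line that is not parallel to the hyperplane `π = {x | x (last) = 1}` meets it in exactly one
point, and the first `n` coordinates are Euclidean coordinates on `π`. -/

/-- The point of `π` with coordinates `x`. -/
def chartPoint {n : ℕ} (x : Fin n → ℝ) : E n :=
  WithLp.toLp 2 (Fin.snoc x 1 : Fin (n + 1) → ℝ)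

/-- The oriented Euclidean volume of the simplex in `π` whose vertices have the coordinates
`x 0, …, x n`. -/
def simplexVolume {n : ℕ} (x : Fin (n + 1) → Fin n → ℝ) : ℝ :=
  (Matrix.of fun i => (Fin.snoc (x i) 1 : Fin (n + 1) → ℝ)).det / (n ! : ℝ)

lemma chartPoint_ne_zero {n : ℕ} (x : Fin n → ℝ) : chartPoint x ≠ 0 := by
  intro h
  have h' := congrArg (fun v : E n => v (Fin.last n)) h
  simp [chartPoint] at h'

lemma linearIndependent_chartPoint {n : ℕ} {x : Fin (n + 1) → Fin n → ℝ}
    (hx : simplexVolume x ≠ 0) : LinearIndependent ℝ fun i => chartPoint (x i) := by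
  have hdet : (Matrix.of fun i => (Fin.snoc (x i) 1 : Fin (n + 1) → ℝ)).det ≠ 0 := by
    intro h
    exact hx (by simp [simplexVolume, h])
  have h := Matrix.linearIndependent_rows_of_det_ne_zero hdet
  exact h.map' (WithLp.linearEquiv 2 ℝ (Fin (n + 1) → ℝ)).symm.toLinearMap
    (LinearEquiv.ker _)

/-- The domain of the chart: coordinates of the intersection points of `n + 1` independent lines
with `π`. -/
abbrev ChartDomain (n : ℕ) : Type :=
  {x : Fin (n + 1) → Fin n → ℝ // simplexVolume x ≠ 0}

/-- The (inverse of the) chart of `FCF n` associated with `π`. -/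
def chart (n : ℕ) (x : ChartDomain n) : FCF n :=
  ⟨fun i => Projectivization.mk ℝ (chartPoint (x.1 i)) (chartPoint_ne_zero _),
    Projectivization.Independent.mk _ _ (linearIndependent_chartPoint x.2)⟩

/-- The Möbius measure of `FCF n`: in the chart it is the measure of the form
`⋀ dx_{j,i} / V_π(A_1 … A_{n+1})^{n+1}`. The lines missing the chart form a null set of the
measure of any volume form on `FCF n`. -/
def framedMobiusMeasure (n : ℕ) : Measure (FCF n) :=
  Measure.map (chart n)
    ((Measure.comap (Subtype.val : ChartDomain n → Fin (n + 1) → Fin n → ℝ) volume).withDensity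
      fun x => ENNReal.ofReal (1 / |simplexVolume x.1| ^ (n + 1)))

/-- The Möbius measure `μ_n` of `CF n`: the projection of the Möbius measure of `FCF n`, divided by
the number `(n + 1)!` of sheets of the covering `FCF n → CF n`. -/
def mobiusMeasure (n : ℕ) : Measure (CF n) :=
  ((n + 1)! : ℝ≥0∞)⁻¹ • Measure.map (proj n) (framedMobiusMeasure n)

/-- The relative frequency `μ_n (CF_n(F))` of a face `F`. -/
def relativeFrequency (n : ℕ) (F : Set (E n)) : ℝ≥0∞ :=
  mobiusMeasure n (CFWithFace n F)

/-- `F` is a face of some `n`-dimensional continued fraction. -/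
def IsFaceOfSomeCF (n : ℕ) (F : Set (E n)) : Prop :=
  (CFWithFace n F).Nonempty

/-! ### The maps defining the Möbius measure are measurable -/

lemma measurable_proj (n : ℕ) : Measurable (proj n) :=
  measurable_quotient_mk''

lemma measurable_chart (n : ℕ) : Measurable (chart n) := by
  refine Measurable.subtype_mk (measurable_pi_lambda _ fun i => ?_)
  have h1 : Measurable (Projectivization.mk' ℝ : {v : E n // v ≠ 0} → ℙ ℝ (E n)) :=
    fun _ ht => ht
  have h2 : Continuous fun x : ChartDomain n => chartPoint (x.1 i) := by
    unfold chartPoint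
    refine (PiLp.continuous_toLp 2 _).comp (continuous_pi fun j => ?_)
    refine Fin.lastCases ?_ (fun j => ?_) j
    · simpa using continuous_const
    · simp only [Fin.snoc_castSucc]
      exact (continuous_apply_apply i j).comp continuous_subtype_val
  exact h1.comp (h2.measurable.subtype_mk (h := fun x => chartPoint_ne_zero (x.1 i)))

end KleinCF

end

noncomputable section

namespace KleinCF

open Filter Topology Set Module

/-! Suppose that `F` spans the plane `h = 1`. A continued fraction has the face `F` exactly when one
of its orthants `O` satisfies `SpansSlice`: `h` is positive on the closed orthant minus the origin,
and the integer points of the slice `h = 1` have convex hull `F`. Necessity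
(`pos_and_convexHull_eq_of_face`) holds because a plane cutting the sail in a nonempty convex set
supports the hull, and boundedness of `F` makes `h` positive. Sufficiency (`inter_sail_eq`) needs a
gap: no nonzero integer points of the cone below the plane, and none just above it.

At distance one the gap is automatic. At distance two an integer point `x` of the cone with `h x =
1/2` would put `2x` in `F`. But a bounded face contains no `2m` with `m ≠ 0` an integer point
(`two_smul_notMem_face`): since `m`, `2m`, `3m` all lie in the hull, the supporting plane would pass
through the origin and contain every multiple of `m`. The same fact excludes vertices and edges at
distance two, as each would contain such a point (`exists_two_smul_mem`), so both faces are
two-dimensional.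

The criterion sees only the integer points of the plane. Hence the integer-affine map, restricted to
the first plane and extended linearly (`exists_linearEquiv_extension`), matches the two sets of
continued fractions. The extension need not preserve the lattice, but the Möbius measure is
invariant under every linear automorphism (`mobiusMeasure_preimage_mapCF`). -/

/-! ### Pointed cones and the convex hulls of their integer points -/

/-- A nonempty open convex cone whose closure contains no straight line. -/
structure IsPointedCone {n : ℕ} (O : Set (E n)) : Prop where
  isOpen : IsOpen O
  convex : Convex ℝ O
  nonempty : O.Nonempty
  smul_mem : ∀ {t : ℝ} {x : E n}, 0 < t → x ∈ O → t • x ∈ O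
  pointed : ∃ ℓ : E n →ₗ[ℝ] ℝ, ∀ x ∈ closure O, x ≠ 0 → 0 < ℓ x

/-- The convex hull of the nonzero integer points of the closure of `O`. -/
def integerHull {n : ℕ} (O : Set (E n)) : Set (E n) :=
  convexHull ℝ ((closure O ∩ integerPoints n) \ {0})

lemma add_mem_integerPoints {n : ℕ} {x y : E n} (hx : x ∈ integerPoints n)
    (hy : y ∈ integerPoints n) : x + y ∈ integerPoints n := by
  intro i
  obtain ⟨a, ha⟩ := hx i
  obtain ⟨b, hb⟩ := hy i
  exact ⟨a + b, by simp [ha, hb]⟩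

lemma zsmul_mem_integerPoints {n : ℕ} {x : E n} (k : ℤ) (hx : x ∈ integerPoints n) :
    (k : ℝ) • x ∈ integerPoints n := by
  intro i
  obtain ⟨a, ha⟩ := hx i
  exact ⟨k * a, by simp [ha]⟩

lemma sub_mem_integerPoints {n : ℕ} {x y : E n} (hx : x ∈ integerPoints n)
    (hy : y ∈ integerPoints n) : x - y ∈ integerPoints n := by
  have h := add_mem_integerPoints hx (zsmul_mem_integerPoints (-1) hy)
  simpa [sub_eq_add_neg] using h

lemma two_smul_mem_integerPoints {n : ℕ} {x : E n} (hx : x ∈ integerPoints n) :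
    (2 : ℝ) • x ∈ integerPoints n := by
  simpa using zsmul_mem_integerPoints 2 hx

lemma one_le_norm_of_mem_integerPoints {n : ℕ} {x : E n} (hx : x ∈ integerPoints n)
    (h0 : x ≠ 0) : 1 ≤ ‖x‖ := by
  obtain ⟨i, hi⟩ : ∃ i, x i ≠ 0 := by
    by_contra! h
    exact h0 (by ext i; simpa using h i)
  obtain ⟨m, hm⟩ := hx i
  have h1 : (1 : ℝ) ≤ |x i| := by
    rw [hm] at hi ⊢
    have : m ≠ 0 := by rintro rfl; simp at hi
    rw [← Int.cast_abs]
    exact_mod_cast Int.one_le_abs this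
  exact h1.trans (by simpa using PiLp.norm_apply_le x i)

/-- Every vector is a limit of integer vectors divided by `N`. -/
lemma exists_tendsto_integerPoints {n : ℕ} (e : E n) : ∃ m : ℕ → E n,
    (∀ N, m N ∈ integerPoints n) ∧ Tendsto (fun N : ℕ => (N : ℝ)⁻¹ • m N) atTop (𝓝 e) := by
  refine ⟨fun N => WithLp.toLp 2 fun i => (⌊(N : ℝ) * e i⌋ : ℝ),
    fun N i => ⟨⌊(N : ℝ) * e i⌋, rfl⟩, ?_⟩
  have h : Tendsto (fun N : ℕ => fun i => (N : ℝ)⁻¹ * (⌊(N : ℝ) * e i⌋ : ℝ)) atTop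
      (𝓝 fun i => e i) := by
    refine tendsto_pi_nhds.2 fun i => ?_
    have hz : Tendsto (fun N : ℕ => e i - (N : ℝ)⁻¹) atTop (𝓝 (e i)) := by
      simpa using tendsto_const_nhds.sub (tendsto_inv_atTop_nhds_zero_nat (𝕜 := ℝ))
    refine tendsto_of_tendsto_of_tendsto_of_le_of_le' hz tendsto_const_nhds ?_ ?_
    · filter_upwards [eventually_gt_atTop 0] with N hN
      have hN' : (0 : ℝ) < N := by exact_mod_cast hN
      have := (Int.lt_floor_add_one ((N : ℝ) * e i)).le
      rw [inv_mul_eq_div, le_div_iff₀ hN']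
      have : (e i - (N : ℝ)⁻¹) * N = N * e i - 1 := by field_simp
      linarith
    · filter_upwards [eventually_gt_atTop 0] with N hN
      have hN' : (0 : ℝ) < N := by exact_mod_cast hN
      have := Int.floor_le ((N : ℝ) * e i)
      rw [inv_mul_eq_div, div_le_iff₀ hN']
      linarith
  exact ((PiLp.continuous_toLp 2 _).tendsto _).comp h

namespace IsPointedCone

variable {n : ℕ} {O : Set (E n)}

lemma smul_mem_closure (hO : IsPointedCone O) {t : ℝ} {x : E n} (ht : 0 < t)
    (hx : x ∈ closure O) : t • x ∈ closure O :=
  map_mem_closure (continuous_const_smul t) hx fun _ hy => hO.smul_mem ht hy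

lemma add_mem_closure (hO : IsPointedCone O) {x y : E n}
    (hx : x ∈ closure O) (hy : y ∈ closure O) : x + y ∈ closure O := by
  have h := hO.convex.closure hx hy (a := 1 / 2) (b := 1 / 2) (by norm_num) (by norm_num)
    (by norm_num)
  have h2 := hO.smul_mem_closure (t := 2) (by norm_num) h
  simpa [smul_add, smul_smul] using h2

/-- A linear functional that is positive on the closed cone dominates the norm there. -/
lemma exists_mul_norm_le (hO : IsPointedCone O) (f : E n →ₗ[ℝ] ℝ)
    (hf : ∀ x ∈ closure O, x ≠ 0 → 0 < f x) :
    ∃ c > 0, ∀ x ∈ closure O, c * ‖x‖ ≤ f x := by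
  have hfc : Continuous f := f.continuous_of_finiteDimensional
  have hK : IsCompact (closure O ∩ Metric.sphere (0 : E n) 1) :=
    (isCompact_sphere 0 1).inter_left isClosed_closure
  rcases (closure O ∩ Metric.sphere (0 : E n) 1).eq_empty_or_nonempty with he | hne
  -- An empty cross-section leaves no nonzero vector in the closed cone, so any positive constant
  -- works.
  · refine ⟨1, one_pos, fun x hx => ?_⟩
    by_cases h0 : x = 0
    · simp [h0]
    · exfalso
      have hn : 0 < ‖x‖ := norm_pos_iff.2 h0
      have : ‖x‖⁻¹ • x ∈ closure O ∩ Metric.sphere (0 : E n) 1 :=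
        ⟨hO.smul_mem_closure (inv_pos.2 hn) hx, by simp [norm_smul, hn.ne']⟩
      simp [he] at this
  · obtain ⟨y, hy, hmin⟩ := hK.exists_isMinOn hne hfc.continuousOn
    have hy0 : y ≠ 0 := by
      rintro rfl
      simpa using hy.2
    refine ⟨f y, hf y hy.1 hy0, fun x hx => ?_⟩
    by_cases h0 : x = 0
    · simp [h0]
    · have hn : 0 < ‖x‖ := norm_pos_iff.2 h0
      have : f y ≤ f (‖x‖⁻¹ • x) := hmin
        ⟨hO.smul_mem_closure (inv_pos.2 hn) hx, by simp [norm_smul, hn.ne']⟩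
      rw [map_smul, smul_eq_mul, inv_mul_eq_div, le_div_iff₀ hn] at this
      exact this

lemma integerHull_subset (hO : IsPointedCone O) : integerHull O ⊆ closure O :=
  convexHull_min (fun _ hx => hx.1.1) hO.convex.closure

lemma closure_integerHull_subset (hO : IsPointedCone O) :
    closure (integerHull O) ⊆ closure O :=
  closure_minimal hO.integerHull_subset isClosed_closure

lemma subset_integerHull {m : E n} (hm : m ∈ integerPoints n) (hmO : m ∈ closure O)
    (h0 : m ≠ 0) : m ∈ integerHull O :=
  subset_convexHull ℝ _ ⟨⟨hmO, hm⟩, h0⟩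

/-- The sum of two elements of the closed cone vanishes only if the first does. -/
lemma add_ne_zero (hO : IsPointedCone O) {x y : E n} (hx : x ∈ closure O) (hy : y ∈ closure O)
    (h0 : x ≠ 0) : x + y ≠ 0 := by
  obtain ⟨ℓ, hℓ⟩ := hO.pointed
  intro h
  have h1 := hℓ x hx h0
  have h2 : y ≠ 0 := by
    rintro rfl
    exact h0 (by simpa using h)
  have h3 := hℓ y hy h2
  have h4 : ℓ (x + y) = 0 := by rw [h, map_zero]
  rw [map_add] at h4
  linarith

/-- The closure of the integer hull is stable under translations by elements of the cone. -/
lemma add_mem_closure_integerHull (hO : IsPointedCone O) {p e : E n}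
    (hp : p ∈ integerPoints n) (hpO : p ∈ closure O) (h0 : p ≠ 0) (he : e ∈ closure O) :
    p + e ∈ closure (integerHull O) := by
  have key : ∀ e ∈ O, p + e ∈ closure (integerHull O) := by
    intro e he
    obtain ⟨m, hm, hlim⟩ := exists_tendsto_integerPoints e
    refine mem_closure_of_tendsto (tendsto_const_nhds.add hlim) ?_
    -- Openness of `O` puts `m N` in `O` for large `N`, and `p + m N / N` is a convex combination of
    -- `p` and `p + m N`.
    filter_upwards [eventually_ge_atTop 1, hlim (hO.isOpen.mem_nhds he)] with N hN hmN
    have hN' : (1 : ℝ) ≤ N := by exact_mod_cast hN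
    have hN0 : (0 : ℝ) < N := by linarith
    have hmO : m N ∈ O := by
      have := hO.smul_mem hN0 hmN
      rwa [smul_smul, mul_inv_cancel₀ hN0.ne', one_smul] at this
    have h1 : p ∈ integerHull O := subset_integerHull hp hpO h0
    have h2 : p + m N ∈ integerHull O :=
      subset_integerHull (add_mem_integerPoints hp (hm N))
        (hO.add_mem_closure hpO (subset_closure hmO))
        (hO.add_ne_zero hpO (subset_closure hmO) h0)
    have hconv : Convex ℝ (integerHull O) := convex_convexHull ℝ _
    have h3 := hconv h1 h2
      (a := 1 - (N : ℝ)⁻¹) (b := (N : ℝ)⁻¹) (by simpa using inv_le_one_of_one_le₀ hN')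
      (by positivity) (by ring)
    convert h3 using 1
    module
  have h := map_mem_closure (continuous_const_add p) he key
  rwa [closure_closure] at h

lemma exists_integer_mem (hO : IsPointedCone O) :
    ∃ p ∈ integerPoints n, p ∈ closure O ∧ p ≠ 0 := by
  obtain ⟨e, he, he0⟩ := (dense_compl_singleton (0 : E n)).inter_open_nonempty O hO.isOpen
    hO.nonempty
  obtain ⟨m, hm, hlim⟩ := exists_tendsto_integerPoints e
  obtain ⟨N, hN, hmN, hm0⟩ := ((eventually_gt_atTop 0).and
    ((hlim.eventually_mem (hO.isOpen.mem_nhds he)).and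
      (hlim.eventually_mem (isOpen_compl_singleton.mem_nhds he0)))).exists
  have hN0 : (0 : ℝ) < N := by exact_mod_cast hN
  have hmO : m N ∈ O := by
    have := hO.smul_mem hN0 hmN
    rwa [smul_smul, mul_inv_cancel₀ hN0.ne', one_smul] at this
  exact ⟨m N, hm N, subset_closure hmO, fun h => hm0 (by simp [h])⟩

/-- The affine span of the hull is closed, so it contains the closure of the hull and with it the
open set `p + O`; a convex set with full affine span has interior points. -/
lemma interior_integerHull_nonempty (hO : IsPointedCone O) :
    (interior (integerHull O)).Nonempty := by
  have hconv : Convex ℝ (integerHull O) := convex_convexHull ℝ _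
  rw [hconv.interior_nonempty_iff_affineSpan_eq_top]
  obtain ⟨p, hp, hpO, hp0⟩ := hO.exists_integer_mem
  have hopen : IsOpen ((p + ·) '' O) := (isOpenMap_add_left p) _ hO.isOpen
  have hsub : (p + ·) '' O ⊆ affineSpan ℝ (integerHull O) := by
    rintro _ ⟨e, he, rfl⟩
    exact closure_minimal (subset_affineSpan ℝ _)
      (AffineSubspace.closed_of_finiteDimensional _)
      (hO.add_mem_closure_integerHull hp hpO hp0 (subset_closure he))
  have htop := hopen.affineSpan_eq_top (hO.nonempty.image _)
  rw [eq_top_iff, ← htop]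
  exact affineSpan_le.2 hsub

lemma closure_integerHull_subset_halfspace (hO : IsPointedCone O) {f : E n →ₗ[ℝ] ℝ} {a : ℝ}
    (h : ∀ x ∈ interior (integerHull O), a < f x) :
    ∀ x ∈ closure (integerHull O), a ≤ f x := by
  have hfc : Continuous f := f.continuous_of_finiteDimensional
  have hconv : Convex ℝ (integerHull O) := convex_convexHull ℝ _
  have h1 : closure (interior (integerHull O)) = closure (integerHull O) :=
    hconv.closure_interior_eq_closure_of_nonempty_interior hO.interior_integerHull_nonempty
  rw [← h1]
  exact closure_minimal (fun x hx => (h x hx).le) (isClosed_le continuous_const hfc)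

end IsPointedCone

/-! ### Faces of the integer hull of a pointed cone -/

/-- A hyperplane is the level set of a linear functional. -/
lemma exists_functional_of_finrank_direction {n : ℕ} (H : AffineSubspace ℝ (E n))
    (hne : (H : Set (E n)).Nonempty) (hH : finrank ℝ H.direction = n) :
    ∃ (f : E n →ₗ[ℝ] ℝ) (a : ℝ), ∀ x, x ∈ H ↔ f x = a := by
  obtain ⟨p, hp⟩ := hne
  have hlt : H.direction < ⊤ := by
    refine lt_top_iff_ne_top.2 fun h => ?_
    rw [h, finrank_top] at hH
    simp at hH
  obtain ⟨f, hf0, hker⟩ := Submodule.exists_le_ker_of_lt_top _ hlt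
  have hrank : finrank ℝ (LinearMap.ker f) = n := by
    have h1 := LinearMap.finrank_range_add_finrank_ker f
    rw [LinearMap.range_eq_top.2 (LinearMap.surjective hf0), finrank_top] at h1
    simp at h1
    omega
  have heq : H.direction = LinearMap.ker f :=
    Submodule.eq_of_le_of_finrank_eq hker (hH.trans hrank.symm)
  refine ⟨f, f p, fun x => ?_⟩
  rw [← AffineSubspace.vsub_right_mem_direction_iff_mem hp, heq, LinearMap.mem_ker, vsub_eq_sub,
    map_sub, sub_eq_zero]

namespace IsPointedCone

variable {n : ℕ} {O : Set (E n)}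

/-- A ray that starts in the integer hull and on which `ℓ` is constant meets the sail. -/
lemma exists_mem_sail_of_ray (hO : IsPointedCone O) {ℓ : E n →ₗ[ℝ] ℝ}
    (hℓ : ∀ x ∈ closure O, x ≠ 0 → 0 < ℓ x) {x u : E n} (hx : x ∈ integerHull O) (hu : u ≠ 0)
    (hu0 : ℓ u = 0) : ∃ t : ℝ, 0 ≤ t ∧ x + t • u ∈ sail O := by
  obtain ⟨c, hc, hcl⟩ := hO.exists_mul_norm_le ℓ hℓ
  have hun : 0 < ‖u‖ := norm_pos_iff.2 hu
  -- Along the ray `ℓ` keeps the value `ℓ x`, so points of the cone there have norm at most `ℓ x /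
  -- c`. The chosen `T` makes the norm at least `ℓ x / c + 1`.
  obtain ⟨T, hT0, hT⟩ : ∃ T : ℝ, 0 ≤ T ∧ x + T • u ∉ integerHull O := by
    have hlx : 0 ≤ ℓ x := (by positivity : 0 ≤ c * ‖x‖).trans (hcl x (hO.integerHull_subset hx))
    refine ⟨(ℓ x / c + ‖x‖ + 1) / ‖u‖, by positivity, fun h => ?_⟩
    have h1 := hcl _ (hO.integerHull_subset h)
    rw [map_add, map_smul, hu0, smul_zero, add_zero, mul_comm, ← le_div_iff₀ hc] at h1
    have h2 : ‖((ℓ x / c + ‖x‖ + 1) / ‖u‖) • u‖ = ℓ x / c + ‖x‖ + 1 := by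
      rw [norm_smul, Real.norm_of_nonneg (by positivity)]
      field_simp
    have h3 := norm_sub_le (x + ((ℓ x / c + ‖x‖ + 1) / ‖u‖) • u) x
    rw [add_sub_cancel_left, h2] at h3
    linarith
  have hcon : IsPreconnected ((fun t : ℝ => x + t • u) '' Icc 0 T) :=
    isPreconnected_Icc.image _ (by fun_prop)
  by_contra! hno
  have hcases : ∀ t : ℝ, 0 ≤ t →
      x + t • u ∈ interior (integerHull O) ∨ x + t • u ∈ (closure (integerHull O))ᶜ := by
    intro t ht
    by_contra! hnot
    exact hno t ht ⟨not_not.1 hnot.2, hnot.1⟩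
  -- A segment avoiding the frontier would be split by the interior and the exterior of the hull,
  -- contradicting connectedness.
  obtain ⟨y, -, hy1, hy2⟩ := hcon _ _ isOpen_interior isClosed_closure.isOpen_compl
    (by rintro _ ⟨t, ht, rfl⟩; exact hcases t ht.1)
    ⟨x, ⟨0, ⟨le_rfl, hT0⟩, by simp⟩, by
      have := hcases 0 le_rfl
      rw [zero_smul, add_zero] at this
      exact this.resolve_right fun h => h (subset_closure hx)⟩
    ⟨_, ⟨T, ⟨hT0, le_rfl⟩, rfl⟩, (hcases T hT0).resolve_left fun h => hT (interior_subset h)⟩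
  exact hy2 (subset_closure (interior_subset hy1))

/-- A hyperplane that meets the sail in a convex set misses the interior of the hull. -/
lemma notMem_interior_of_convex_inter (hO : IsPointedCone O) (hn : 2 ≤ n)
    {H : AffineSubspace ℝ (E n)} (hH : finrank ℝ H.direction = n)
    (hconv : Convex ℝ ((H : Set (E n)) ∩ sail O)) {x : E n} (hx : x ∈ H) :
    x ∉ interior (integerHull O) := by
  intro hxi
  obtain ⟨ℓ, hℓ⟩ := hO.pointed
  -- The kernel of `ℓ` on the direction of `H` has dimension at least `n - 1`; this is where `2 ≤ n`
  -- enters.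
  obtain ⟨u, hu, hu0⟩ : ∃ u : H.direction, u ≠ 0 ∧ ℓ u = 0 := by
    have h1 := LinearMap.finrank_range_add_finrank_ker (ℓ.domRestrict H.direction)
    have h2 := Submodule.finrank_le (LinearMap.range (ℓ.domRestrict H.direction))
    rw [finrank_self] at h2
    have h3 : 0 < finrank ℝ (LinearMap.ker (ℓ.domRestrict H.direction)) := by omega
    obtain ⟨w, hw⟩ := finrank_pos_iff_exists_ne_zero.1 h3
    exact ⟨w.1, fun h => hw (Subtype.ext h), w.2⟩
  have hu' : (u : E n) ≠ 0 := fun h => hu (Subtype.ext h)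
  have hmem : ∀ t : ℝ, x + t • (u : E n) ∈ H := fun t => by
    have := AffineSubspace.vadd_mem_of_mem_direction (H.direction.smul_mem t u.2) hx
    simpa only [vadd_eq_add, add_comm] using this
  obtain ⟨s, hs, hs'⟩ := hO.exists_mem_sail_of_ray hℓ (interior_subset hxi) hu' hu0
  obtain ⟨t, ht, ht'⟩ := hO.exists_mem_sail_of_ray hℓ (interior_subset hxi)
    (u := -(u : E n)) (neg_ne_zero.2 hu') (by simp [hu0])
  -- The two opposite rays from `x` meet the sail inside `H`, so convexity would put the interior
  -- point `x` on the sail.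
  have hself : x ∈ (H : Set (E n)) ∩ sail O := by
    rcases (add_nonneg hs ht).eq_or_lt with h0 | hpos
    · have : s = 0 := by linarith
      rw [this, zero_smul, add_zero] at hs'
      exact ⟨hx, hs'⟩
    · have h := hconv ⟨hmem s, hs'⟩
        ⟨by simpa using hmem (-t), ht'⟩ (a := t / (s + t)) (b := s / (s + t))
        (by positivity) (by positivity) (by field_simp; ring)
      convert h using 1
      have h1 : t / (s + t) + s / (s + t) = 1 := by field_simp; ring
      have h2 : t / (s + t) * s - s / (s + t) * t = 0 := by field_simp; ring
      calc x = (t / (s + t) + s / (s + t)) • x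
            + (t / (s + t) * s - s / (s + t) * t) • (u : E n) := by rw [h1, h2]; simp
        _ = _ := by module
  exact hself.2.2 hxi

/-- A hyperplane that meets the sail in a nonempty convex set is a supporting hyperplane of the
hull. -/
lemma exists_supporting_functional (hO : IsPointedCone O) (hn : 2 ≤ n)
    {H : AffineSubspace ℝ (E n)} (hH : finrank ℝ H.direction = n)
    (hconv : Convex ℝ ((H : Set (E n)) ∩ sail O)) (hne : ((H : Set (E n)) ∩ sail O).Nonempty) :
    ∃ (f : E n →ₗ[ℝ] ℝ) (a : ℝ), (∀ x, x ∈ H ↔ f x = a) ∧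
      ∀ x ∈ closure (integerHull O), a ≤ f x := by
  obtain ⟨f, a, hf⟩ := exists_functional_of_finrank_direction H (hne.mono inter_subset_left) hH
  have hfc : Continuous f := f.continuous_of_finiteDimensional
  have hint : ∀ x ∈ interior (integerHull O), f x ≠ a := fun x hx h =>
    hO.notMem_interior_of_convex_inter hn hH hconv ((hf x).2 h) hx
  have hhull : Convex ℝ (integerHull O) := convex_convexHull ℝ _
  have hpre : IsPreconnected (f '' interior (integerHull O)) :=
    hhull.interior.isPreconnected.image f hfc.continuousOn
  obtain ⟨y, hy⟩ := hO.interior_integerHull_nonempty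
  -- The connected interior misses `H`, so `f - a` has constant sign there; if it is negative, `f`
  -- is replaced by `-f`.
  rcases lt_or_gt_of_ne (hint y hy) with hlt | hgt
  · refine ⟨-f, -a, fun x => by rw [hf, LinearMap.neg_apply, neg_inj],
      hO.closure_integerHull_subset_halfspace fun x hx => ?_⟩
    rw [LinearMap.neg_apply, neg_lt_neg_iff]
    by_contra! hle
    obtain ⟨z, hz, hza⟩ := hpre.ordConnected.out (mem_image_of_mem f hy) (mem_image_of_mem f hx)
      ⟨hlt.le, hle⟩
    exact hint z hz hza
  · refine ⟨f, a, hf, hO.closure_integerHull_subset_halfspace fun x hx => ?_⟩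
    by_contra! hle
    obtain ⟨z, hz, hza⟩ := hpre.ordConnected.out (mem_image_of_mem f hx) (mem_image_of_mem f hy)
      ⟨hle, hgt.le⟩
    exact hint z hz hza

lemma frontier_integerHull_subset (hO : IsPointedCone O) : sail O ⊆ closure O :=
  frontier_subset_closure.trans hO.closure_integerHull_subset

/-- A compact convex face of a sail contains no nonzero integer point that is divisible by two. -/
lemma two_smul_notMem_face (hO : IsPointedCone O) (hn : 2 ≤ n)
    {H : AffineSubspace ℝ (E n)} (hH : finrank ℝ H.direction = n)
    (hconv : Convex ℝ ((H : Set (E n)) ∩ sail O))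
    (hbdd : Bornology.IsBounded ((H : Set (E n)) ∩ sail O)) {m : E n}
    (hm : m ∈ integerPoints n) (hm0 : m ≠ 0) : (2 : ℝ) • m ∉ (H : Set (E n)) ∩ sail O := by
  intro h2m
  obtain ⟨f, a, hf, hfa⟩ := hO.exists_supporting_functional hn hH hconv ⟨_, h2m⟩
  have hmO : m ∈ closure O := by
    have := hO.smul_mem_closure (t := 1 / 2) (by norm_num) (hO.frontier_integerHull_subset h2m.2)
    rwa [smul_smul, show (1 / 2 : ℝ) * 2 = 1 by norm_num, one_smul] at this
  have hmK : ∀ k : ℕ, ((k : ℝ) + 1) • m ∈ integerHull O := fun k =>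
    subset_integerHull (by simpa using zsmul_mem_integerPoints (k + 1) hm)
      (hO.smul_mem_closure (by positivity) hmO) (smul_ne_zero (by positivity) hm0)
  -- The points `m` and `3m` (indices 0 and 2 of `hmK`) give `a ≤ a / 2` and `a ≤ 3a / 2`, hence `a
  -- = 0`.
  have e2 : 2 * f m = a := by simpa using (hf _).1 h2m.1
  have e1 := hfa _ (subset_closure (hmK 0))
  have e3 := hfa _ (subset_closure (hmK 2))
  simp only [map_smul, smul_eq_mul] at e1 e3
  norm_num at e1 e3
  have ha : a = 0 := by linarith
  have hfm : f m = 0 := by linarith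
  have hface : ∀ k : ℕ, ((k : ℝ) + 1) • m ∈ (H : Set (E n)) ∩ sail O := by
    intro k
    have hkH : ((k : ℝ) + 1) • m ∈ H := (hf _).2 (by simp [hfm, ha])
    exact ⟨hkH, subset_closure (hmK k), hO.notMem_interior_of_convex_inter hn hH hconv hkH⟩
  obtain ⟨R, hR⟩ := hbdd.exists_norm_le
  obtain ⟨k, hk⟩ := exists_nat_gt R
  have h1 := hR _ (hface k)
  rw [norm_smul, Real.norm_of_nonneg (by positivity)] at h1
  have h2 := one_le_norm_of_mem_integerPoints hm hm0
  nlinarith [(k.cast_nonneg : (0 : ℝ) ≤ k)]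

/-- Conditions satisfied by the faces of the sail in a hyperplane `h = 1`. -/
lemma pos_and_convexHull_eq_of_face (hO : IsPointedCone O) (hn : 2 ≤ n)
    {H : AffineSubspace ℝ (E n)} (hH : finrank ℝ H.direction = n) {h : E n →ₗ[ℝ] ℝ}
    (hh : ∀ x, x ∈ H ↔ h x = 1) {s : Set (E n)} (hs : s ⊆ integerPoints n) (hsne : s.Nonempty)
    (hbdd : Bornology.IsBounded (convexHull ℝ s))
    (hF : convexHull ℝ s = (H : Set (E n)) ∩ sail O) :
    (∀ x ∈ closure O, x ≠ 0 → 0 < h x) ∧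
      convexHull ℝ ((closure O ∩ {x | h x = 1}) ∩ integerPoints n) = convexHull ℝ s := by
  have hconv : Convex ℝ ((H : Set (E n)) ∩ sail O) := hF ▸ convex_convexHull ℝ s
  have hhc : Continuous h := h.continuous_of_finiteDimensional
  obtain ⟨p, hp⟩ := hsne
  have hpF : p ∈ (H : Set (E n)) ∩ sail O := hF ▸ subset_convexHull ℝ s hp
  have hpO : p ∈ closure O := hO.frontier_integerHull_subset hpF.2
  have hp1 : h p = 1 := (hh p).1 hpF.1
  have hp0 : p ≠ 0 := by
    rintro rfl
    simp at hp1
  have hge : ∀ x ∈ closure (integerHull O), 1 ≤ h x := by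
    obtain ⟨f, a, hf, hfa⟩ := hO.exists_supporting_functional hn hH hconv ⟨_, hpF⟩
    have hfp : f p = a := (hf p).1 hpF.1
    -- `f` is the multiple `a • h` of `h`
    have hfh : ∀ x, f x = a * h x := by
      intro x
      have h1 : x + (1 - h x) • p ∈ H := (hh _).2 (by simp [hp1])
      have h2 : f x + (1 - h x) * f p = a := by simpa using (hf _).1 h1
      rw [hfp] at h2
      linarith
    -- Evaluating at the hull point `2p` gives `a ≤ 2a`.
    have ha : 0 ≤ a := by
      have := hfa _ (subset_closure (subset_integerHull
        (two_smul_mem_integerPoints (hs hp)) (hO.smul_mem_closure two_pos hpO)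
        (smul_ne_zero two_ne_zero hp0)))
      rw [hfh, map_smul, hp1, smul_eq_mul] at this
      linarith
    rcases ha.eq_or_lt with h0 | hpos
    · exfalso
      have : (0 : E n) ∈ H := (hf 0).2 (by simp [← h0])
      simpa using (hh 0).1 this
    · intro x hx
      have := hfa x hx
      rw [hfh] at this
      nlinarith
  -- Translating `p` by `x` stays in the closed hull, so `1 ≤ 1 + h x`.
  have hnonneg : ∀ x ∈ closure O, 0 ≤ h x := by
    intro x hx
    by_contra! hneg
    have h1 := hge _ (hO.add_mem_closure_integerHull (hs hp) hpO hp0 hx)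
    rw [map_add, hp1] at h1
    linarith
  have hface : ∀ x ∈ closure (integerHull O), h x = 1 → x ∈ (H : Set (E n)) ∩ sail O :=
    fun x hx hx1 => ⟨(hh x).2 hx1, hx,
      hO.notMem_interior_of_convex_inter hn hH hconv ((hh x).2 hx1)⟩
  refine ⟨fun x hx hx0 => (hnonneg x hx).lt_of_ne fun hx1 => ?_, ?_⟩
  -- If `h x = 0`, the whole ray from `p` in direction `x` lies in the face. The multiple below
  -- moves `p` beyond the bound `R`.
  · obtain ⟨R, hR⟩ := hbdd.exists_norm_le
    have hR0 : 0 ≤ R := (norm_nonneg _).trans (hR p (subset_convexHull ℝ s hp))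
    have hxn : 0 < ‖x‖ := norm_pos_iff.2 hx0
    have h1 := hface _ (hO.add_mem_closure_integerHull (hs hp) hpO hp0
      (hO.smul_mem_closure (t := (R + ‖p‖ + 1) / ‖x‖) (by positivity) hx))
      (by simp [hp1, ← hx1])
    rw [← hF] at h1
    have h2 := hR _ h1
    have h3 := norm_sub_le (p + ((R + ‖p‖ + 1) / ‖x‖) • x) p
    rw [add_sub_cancel_left, norm_smul, Real.norm_of_nonneg (by positivity),
      div_mul_cancel₀ _ hxn.ne'] at h3
    linarith
  · refine subset_antisymm (convexHull_min ?_ (convex_convexHull ℝ s)) (convexHull_mono ?_)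
    · rintro x ⟨⟨hxO, hx1⟩, hx⟩
      rw [hF]
      refine hface x (subset_closure (subset_integerHull hx hxO ?_)) hx1
      rintro rfl
      simp at hx1
    · intro x hx
      have hxF : x ∈ (H : Set (E n)) ∩ sail O := hF ▸ subset_convexHull ℝ s hx
      exact ⟨⟨hO.frontier_integerHull_subset hxF.2, (hh x).1 hxF.1⟩, hs hx⟩

/-- The part of the closure of the integer hull in a plane `h = 1` below which there are no integer
points, provided that there is a gap between that plane and the next integer points. -/
lemma closure_integerHull_inter_eq (hO : IsPointedCone O) {h : E n →ₗ[ℝ] ℝ}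
    (hpos : ∀ x ∈ closure O, x ≠ 0 → 0 < h x) {ε : ℝ} (hε : 0 < ε)
    (hgap : ∀ x ∈ closure O, x ∈ integerPoints n → x ≠ 0 → h x = 1 ∨ 1 + ε ≤ h x) {F : Set (E n)}
    (hF : convexHull ℝ ((closure O ∩ {x | h x = 1}) ∩ integerPoints n) = F) (hne : F.Nonempty)
    (hcomp : IsCompact F) :
    (∀ x ∈ integerHull O, 1 ≤ h x) ∧ closure (integerHull O) ∩ {x | h x = 1} = F := by
  have hhc : Continuous h := h.continuous_of_finiteDimensional
  obtain ⟨c, hc, hcl⟩ := hO.exists_mul_norm_le h hpos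
  obtain ⟨p, hp⟩ := hne
  have hFconv : Convex ℝ F := hF ▸ convex_convexHull ℝ _
  have hF1 : ∀ x ∈ F, h x = 1 := by
    rw [← hF]
    exact convexHull_min (fun x hx => hx.1.2) (convex_hyperplane h.isLinear 1)
  -- `Q` is a closed convex set that contains the hull and meets the plane in `F`
  obtain ⟨M, hM0, hM⟩ : ∃ M : ℝ, 0 ≤ M ∧ ∀ t : ℝ, 1 + ε ≤ t → t / c + ‖p‖ ≤ M * (t - 1) := by
    refine ⟨(1 / c * (1 + ε) + ‖p‖) / ε, by positivity, fun t ht => ?_⟩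
    rw [div_mul_eq_mul_div, le_div_iff₀ hε, div_add' _ _ _ hc.ne', div_mul_eq_mul_div,
      div_le_iff₀ hc]
    have e : (1 / c * (1 + ε) + ‖p‖) * (t - 1) * c
        = (1 + ε) * (t - 1) + ‖p‖ * c * (t - 1) := by field_simp
    rw [e]
    have : 0 ≤ ‖p‖ * c := by positivity
    nlinarith
  set Q : Set (E n) := {x | Metric.infDist x F ≤ M * (h x - 1)} with hQ
  have hQclosed : IsClosed Q :=
    isClosed_le (Metric.continuous_infDist_pt F) (by fun_prop)
  have hQconv : Convex ℝ Q := by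
    intro x hx y hy a b ha hb hab
    obtain ⟨x', hx', hxd⟩ := hcomp.exists_infDist_eq_dist ⟨p, hp⟩ x
    obtain ⟨y', hy', hyd⟩ := hcomp.exists_infDist_eq_dist ⟨p, hp⟩ y
    rw [hQ, mem_ofPred_eq, hxd] at hx
    rw [hQ, mem_ofPred_eq, hyd] at hy
    refine (Metric.infDist_le_dist_of_mem (hFconv hx' hy' ha hb hab)).trans ?_
    calc dist (a • x + b • y) (a • x' + b • y')
        ≤ dist (a • x) (a • x') + dist (b • y) (b • y') := dist_add_add_le _ _ _ _
      _ = a * dist x x' + b * dist y y' := by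
        rw [dist_smul₀, dist_smul₀, Real.norm_of_nonneg ha, Real.norm_of_nonneg hb]
      _ ≤ a * (M * (h x - 1)) + b * (M * (h y - 1)) := by gcongr
      _ = M * (h (a • x + b • y) - 1) := by
        simp only [map_add, map_smul, smul_eq_mul]
        linear_combination -M * hab
  have hsub : integerHull O ⊆ Q := by
    refine convexHull_min ?_ hQconv
    rintro x ⟨⟨hxO, hx⟩, hx0⟩
    rcases hgap x hxO hx hx0 with h1 | h1
    · have : x ∈ F := hF ▸ subset_convexHull ℝ _ ⟨⟨hxO, h1⟩, hx⟩
      simp [hQ, Metric.infDist_zero_of_mem this, h1]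
    · refine (Metric.infDist_le_dist_of_mem hp).trans ?_
      rw [dist_eq_norm]
      refine (norm_sub_le _ _).trans (le_trans ?_ (hM _ h1))
      gcongr
      rw [le_div_iff₀ hc, mul_comm]
      exact hcl x hxO
  refine ⟨fun x hx => ?_, subset_antisymm ?_ ?_⟩
  · refine convexHull_min (t := {x | 1 ≤ h x}) ?_ (convex_halfSpace_ge h.isLinear 1) hx
    rintro y ⟨⟨hyO, hy⟩, hy0⟩
    rcases hgap y hyO hy hy0 with h1 | h1
    · exact h1.ge
    · exact (le_add_of_nonneg_right hε.le).trans h1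
  · rintro x ⟨hx, hx1⟩
    have h1 : Metric.infDist x F ≤ M * (h x - 1) := closure_minimal hsub hQclosed hx
    rw [hx1, sub_self, mul_zero] at h1
    rw [hcomp.isClosed.mem_iff_infDist_zero ⟨p, hp⟩]
    exact le_antisymm h1 Metric.infDist_nonneg
  · refine fun x hx => ⟨subset_closure ?_, hF1 x hx⟩
    rw [← hF] at hx
    refine convexHull_mono ?_ hx
    rintro y ⟨⟨hyO, hy1⟩, hy⟩
    refine ⟨⟨hyO, hy⟩, ?_⟩
    rintro rfl
    simp at hy1

/-- A sufficient condition for a set in a hyperplane to be cut out of the sail by it. -/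
lemma inter_sail_eq (hO : IsPointedCone O) {h : E n →ₗ[ℝ] ℝ}
    (hpos : ∀ x ∈ closure O, x ≠ 0 → 0 < h x) {ε : ℝ} (hε : 0 < ε)
    (hgap : ∀ x ∈ closure O, x ∈ integerPoints n → x ≠ 0 → h x = 1 ∨ 1 + ε ≤ h x) {F : Set (E n)}
    (hF : convexHull ℝ ((closure O ∩ {x | h x = 1}) ∩ integerPoints n) = F) (hne : F.Nonempty)
    (hcomp : IsCompact F) : {x | h x = 1} ∩ sail O = F := by
  obtain ⟨hge, heq⟩ := hO.closure_integerHull_inter_eq hpos hε hgap hF hne hcomp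
  refine subset_antisymm (fun x hx => ?_) fun x hx => ?_
  · rw [← heq]
    exact ⟨frontier_subset_closure hx.2, hx.1⟩
  · rw [← heq] at hx
    refine ⟨hx.2, hx.1, fun hint => ?_⟩
    -- move from `x` towards the origin
    have hlim : Tendsto (fun t : ℝ => t • x) (𝓝[<] 1) (𝓝 x) := by
      have : Tendsto (fun t : ℝ => t • x) (𝓝 1) (𝓝 ((1 : ℝ) • x)) :=
        (continuous_id.smul continuous_const).tendsto 1
      rw [one_smul] at this
      exact this.mono_left nhdsWithin_le_nhds
    obtain ⟨t, ht, ht1⟩ := ((hlim.eventually_mem (isOpen_interior.mem_nhds hint)).and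
      self_mem_nhdsWithin).exists
    have h1 := hge _ (interior_subset ht)
    have hx1 : h x = 1 := hx.2
    rw [map_smul, hx1, smul_eq_mul, mul_one] at h1
    exact absurd h1 (not_le.2 ht1)

end IsPointedCone

/-! ### Orthants and linear changes of coordinates -/

/-- In the basis `v` the orthant is the set of vectors with positive coordinates, and the sum of the
coordinates serves as the functional for pointedness. -/
lemma IsOrthant.isPointedCone {n : ℕ} {l : FCF n} {O : Set (E n)} (h : IsOrthant l O) :
    IsPointedCone O := by
  obtain ⟨v, hv, rfl⟩ := h
  have hli : LinearIndependent ℝ v :=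
    (Projectivization.independent_iff_iSupIndep.1 l.2).linearIndependent _
      (fun i => (hv i).2) fun i => (hv i).1
  let b := basisOfLinearIndependentOfCardEqFinrank hli (by simp)
  let ψ := b.equivFun.toContinuousLinearEquiv
  have hO : {x | ∃ c : Fin (n + 1) → ℝ, (∀ i, 0 < c i) ∧ x = ∑ i, c i • v i}
      = {x | ∀ i, 0 < ψ x i} := by
    ext x
    have hsymm : ∀ c : Fin (n + 1) → ℝ, ψ.symm c = ∑ i, c i • v i := fun c => by
      change b.equivFun.symm c = _
      simp [b, Basis.equivFun_symm_apply]
    constructor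
    · rintro ⟨c, hc, rfl⟩
      rw [← hsymm]
      simpa using hc
    · intro hx
      exact ⟨ψ x, hx, by rw [← hsymm, ψ.symm_apply_apply]⟩
  rw [hO]
  have hcont : ∀ i, Continuous fun x => ψ x i := fun i => (continuous_apply i).comp ψ.continuous
  refine ⟨?_, ?_, ⟨ψ.symm fun _ => 1, by simp⟩, ?_, ?_⟩
  · simp only [ofPred_forall]
    exact isOpen_iInter_of_finite fun i => isOpen_lt continuous_const (hcont i)
  · intro x hx y hy s t hs ht hst i
    have h1 := hx i
    have h2 := hy i
    rcases hs.eq_or_lt with rfl | hs'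
    · have : t = 1 := by linarith
      simpa [this] using h2
    · simp only [map_add, map_smul, Pi.add_apply, Pi.smul_apply, smul_eq_mul]
      positivity
  · intro t x ht hx i
    simpa using mul_pos ht (hx i)
  · refine ⟨∑ i, (LinearMap.proj i).comp b.equivFun.toLinearMap, fun x hx hx0 => ?_⟩
    have hx' : ∀ i, 0 ≤ ψ x i := by
      intro i
      exact closure_minimal (t := {x | 0 ≤ ψ x i}) (fun y hy => (hy i).le)
        (isClosed_le continuous_const (hcont i)) hx
    have hne : ∃ i, ψ x i ≠ 0 := by
      by_contra! hall
      exact hx0 (ψ.map_eq_zero_iff.1 (funext hall))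
    obtain ⟨i, hi⟩ := hne
    have : 0 < ∑ i, ψ x i := Finset.sum_pos' (fun j _ => hx' j)
      ⟨i, Finset.mem_univ i, (hx' i).lt_of_ne' hi⟩
    rw [LinearMap.sum_apply]
    exact this

lemma map_eq_mk_rep {n : ℕ} (A : E n ≃ₗ[ℝ] E n) (p : ℙ ℝ (E n)) :
    p.map A.toLinearMap A.injective
      = Projectivization.mk ℝ (A p.rep) (A.map_ne_zero_iff.2 p.rep_nonzero) := by
  conv_lhs => rw [← p.mk_rep]
  rw [Projectivization.map_mk]
  rfl

/-- The action of linear automorphisms on framed continued fractions. -/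
def mapFCF {n : ℕ} (A : E n ≃ₗ[ℝ] E n) (l : FCF n) : FCF n :=
  ⟨fun i => (l.1 i).map A.toLinearMap A.injective, by
    have h := (Projectivization.independent_iff.1 l.2).map' A.toLinearMap A.ker
    have e : (fun i => (l.1 i).map A.toLinearMap A.injective)
        = fun i => Projectivization.mk ℝ (A (l.1 i).rep)
          (A.map_ne_zero_iff.2 (l.1 i).rep_nonzero) :=
      funext fun i => map_eq_mk_rep A _
    rw [e]
    exact Projectivization.Independent.mk _ _ h⟩

lemma map_symm_map {n : ℕ} (A : E n ≃ₗ[ℝ] E n) (p : ℙ ℝ (E n)) :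
    (p.map A.toLinearMap A.injective).map A.symm.toLinearMap A.symm.injective = p := by
  induction p using Projectivization.ind with
  | h v hv => simp [Projectivization.map_mk]

lemma mapFCF_symm_mapFCF {n : ℕ} (A : E n ≃ₗ[ℝ] E n) (l : FCF n) :
    mapFCF A.symm (mapFCF A l) = l :=
  Subtype.ext (funext fun i => map_symm_map A (l.1 i))

/-- The σ-algebra on projective space is a quotient, so measurability can be tested on nonzero
vectors. -/
lemma measurable_mapFCF {n : ℕ} (A : E n ≃ₗ[ℝ] E n) : Measurable (mapFCF A) := by
  have h1 : Measurable (Projectivization.mk' ℝ : {v : E n // v ≠ 0} → ℙ ℝ (E n)) :=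
    fun _ ht => ht
  have h2 : Measurable fun p : ℙ ℝ (E n) => p.map A.toLinearMap A.injective := by
    have hA : Measurable A := A.toLinearMap.continuous_of_finiteDimensional.measurable
    have h3 : Measurable fun v : {v : E n // v ≠ 0} =>
        (Projectivization.mk' ℝ v).map A.toLinearMap A.injective :=
      h1.comp (f := fun v : {v : E n // v ≠ 0} =>
        (⟨A v.1, A.map_ne_zero_iff.2 v.2⟩ : {v : E n // v ≠ 0}))
        ((hA.comp measurable_subtype_coe).subtype_mk)
    exact fun t ht => h3 ht
  refine Measurable.subtype_mk (measurable_pi_lambda _ fun i => h2.comp ?_)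
  exact (measurable_pi_apply i).comp measurable_subtype_coe

/-- The action of linear automorphisms on continued fractions. -/
def mapCF {n : ℕ} (A : E n ≃ₗ[ℝ] E n) : CF n → CF n :=
  Quotient.map (mapFCF A) (by
    rintro l l' ⟨σ, h⟩
    exact ⟨σ, by funext i; simp [mapFCF, h]⟩)

lemma mapCF_proj {n : ℕ} (A : E n ≃ₗ[ℝ] E n) (l : FCF n) :
    mapCF A (proj n l) = proj n (mapFCF A l) := rfl

lemma mapCF_symm_mapCF {n : ℕ} (A : E n ≃ₗ[ℝ] E n) (c : CF n) :
    mapCF A.symm (mapCF A c) = c := by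
  obtain ⟨l, rfl⟩ := Quotient.exists_rep c
  exact congrArg (proj n) (mapFCF_symm_mapFCF A l)

lemma measurable_mapCF {n : ℕ} (A : E n ≃ₗ[ℝ] E n) : Measurable (mapCF A) := by
  have h : Measurable fun l : FCF n => mapCF A (proj n l) :=
    (measurable_proj n).comp (measurable_mapFCF A)
  exact fun t ht => h ht

/-- The action of a linear automorphism on continued fractions as a measurable equivalence. -/
def mapCFEquiv {n : ℕ} (A : E n ≃ₗ[ℝ] E n) : CF n ≃ᵐ CF n where
  toFun := mapCF A
  invFun := mapCF A.symm
  left_inv := mapCF_symm_mapCF A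
  right_inv := mapCF_symm_mapCF A.symm
  measurable_toFun := measurable_mapCF A
  measurable_invFun := measurable_mapCF A.symm

lemma IsOrthant.image {n : ℕ} (A : E n ≃ₗ[ℝ] E n) {l : FCF n} {O : Set (E n)}
    (h : IsOrthant l O) : IsOrthant (mapFCF A l) (A '' O) := by
  obtain ⟨v, hv, rfl⟩ := h
  refine ⟨fun i => A (v i), fun i => ⟨A.map_ne_zero_iff.2 (hv i).1, ?_⟩, ?_⟩
  · have h1 := (hv i).2
    rw [Projectivization.submodule_eq, Submodule.mem_span_singleton] at h1
    obtain ⟨a, ha⟩ := h1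
    change A (v i) ∈ ((l.1 i).map A.toLinearMap A.injective).submodule
    rw [map_eq_mk_rep, Projectivization.submodule_mk, Submodule.mem_span_singleton]
    exact ⟨a, by rw [← ha, map_smul]⟩
  · ext x
    constructor
    · rintro ⟨_, ⟨c, hc, rfl⟩, rfl⟩
      exact ⟨c, hc, by simp⟩
    · rintro ⟨c, hc, rfl⟩
      exact ⟨_, ⟨c, hc, rfl⟩, by simp⟩

lemma closure_image_linearEquiv {n : ℕ} (A : E n ≃ₗ[ℝ] E n) (O : Set (E n)) :
    closure (A '' O) = A '' closure O :=
  (A.toContinuousLinearEquiv.image_closure O).symm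

/-! ### Integer distance -/

/-- The values of a functional on the integer points of a subspace. -/
def latticeValues {n : ℕ} (h : E n →ₗ[ℝ] ℝ) (W : Submodule ℝ (E n)) : AddSubgroup ℝ where
  carrier := {r | ∃ x ∈ integerPoints n, x ∈ W ∧ h x = r}
  zero_mem' := ⟨0, fun _ => ⟨0, by simp⟩, W.zero_mem, map_zero h⟩
  add_mem' := by
    rintro _ _ ⟨x, hx, hxW, rfl⟩ ⟨y, hy, hyW, rfl⟩
    exact ⟨x + y, add_mem_integerPoints hx hy, W.add_mem hxW hyW, map_add h x y⟩
  neg_mem' := by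
    rintro _ ⟨x, hx, hxW, rfl⟩
    exact ⟨-x, by simpa using zsmul_mem_integerPoints (-1) hx, W.neg_mem hxW, map_neg h x⟩

/-- An affine subspace that misses the origin is the level set `h = 1` in its linear span. -/
lemma exists_functional_eq_one {n : ℕ} {P : AffineSubspace ℝ (E n)}
    (hne : (P : Set (E n)).Nonempty) (h0 : (0 : E n) ∉ P) :
    ∃ h : E n →ₗ[ℝ] ℝ, ∀ x, x ∈ P ↔ x ∈ Submodule.span ℝ (P : Set (E n)) ∧ h x = 1 := by
  obtain ⟨p, hp⟩ := hne
  have hpd : p ∉ P.direction := by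
    intro hpd
    have := (AffineSubspace.vsub_left_mem_direction_iff_mem hp 0).1 (by simpa using hpd)
    exact h0 this
  obtain ⟨f, hfp, hker⟩ := Submodule.exists_le_ker_of_notMem hpd
  have hmem : ∀ x, x ∈ P ↔ x - p ∈ P.direction := fun x =>
    (AffineSubspace.vsub_right_mem_direction_iff_mem hp x).symm
  have hval : ∀ x ∈ P, f x = f p := fun x hx => by
    have : f (x - p) = 0 := hker ((hmem x).1 hx)
    rwa [map_sub, sub_eq_zero] at this
  have hdir : ∀ x ∈ P.direction, f x = 0 := fun x hx => hker hx
  refine ⟨(f p)⁻¹ • f, fun x => ⟨fun hx => ⟨Submodule.subset_span hx, ?_⟩, ?_⟩⟩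
  · simp [hval x hx, hfp]
  · rintro ⟨hx, hx1⟩
    have hspan : Submodule.span ℝ (P : Set (E n)) ≤ P.direction ⊔ Submodule.span ℝ {p} := by
      refine Submodule.span_le.2 fun y hy => ?_
      rw [← sub_add_cancel y p]
      exact Submodule.add_mem_sup ((hmem y).1 hy) (Submodule.mem_span_singleton_self p)
    obtain ⟨d, hd, q, hq, rfl⟩ := Submodule.mem_sup.1 (hspan hx)
    obtain ⟨t, rfl⟩ := Submodule.mem_span_singleton.1 hq
    have ht : t = 1 := by
      rw [LinearMap.smul_apply, map_add, map_smul, hdir d hd, zero_add, smul_eq_mul, smul_eq_mul,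
        mul_left_comm, inv_mul_cancel₀ hfp, mul_one] at hx1
      exact hx1
    rw [hmem, ht, one_smul, add_sub_cancel_right]
    exact hd

-- Off `P`, the plane is the translate by `x` of its own dilation by `1 - h x`, so the distance from
-- the origin is scaled by the absolute value of that factor.
open scoped Pointwise in
lemma infDist_eq_of_functional {n : ℕ} {P : AffineSubspace ℝ (E n)}
    {h : E n →ₗ[ℝ] ℝ}
    (hh : ∀ x, x ∈ P ↔ x ∈ Submodule.span ℝ (P : Set (E n)) ∧ h x = 1) {x : E n}
    (hx : x ∈ Submodule.span ℝ (P : Set (E n))) :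
    Metric.infDist x (P : Set (E n)) = |1 - h x| * Metric.infDist 0 (P : Set (E n)) := by
  rcases eq_or_ne (h x) 1 with h1 | h1
  · have : x ∈ (P : Set (E n)) := (hh x).2 ⟨hx, h1⟩
    rw [Metric.infDist_zero_of_mem this, h1, sub_self, abs_zero, zero_mul]
  · have ht : 1 - h x ≠ 0 := sub_ne_zero.2 (Ne.symm h1)
    have himage : (P : Set (E n)) = (x + ·) '' ((1 - h x) • (P : Set (E n))) := by
      ext y
      constructor
      · intro hy
        have hy' := (hh y).1 hy
        refine ⟨y - x, ⟨(1 - h x)⁻¹ • (y - x), (hh _).2 ⟨?_, ?_⟩, ?_⟩, by simp⟩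
        · exact Submodule.smul_mem _ _ (Submodule.sub_mem _ hy'.1 hx)
        · rw [map_smul, map_sub, hy'.2, smul_eq_mul, inv_mul_cancel₀ ht]
        · exact smul_inv_smul₀ ht (y - x)
      · rintro ⟨_, ⟨z, hz, rfl⟩, rfl⟩
        have hz' := (hh z).1 hz
        refine (hh _).2 ⟨Submodule.add_mem _ hx (Submodule.smul_mem _ _ hz'.1), ?_⟩
        simp [hz'.2]
    have h2 := Metric.infDist_image (isometry_add_left x) (x := 0)
      (t := (1 - h x) • (P : Set (E n)))
    rw [← himage] at h2
    have h3 := infDist_smul₀ ht (P : Set (E n)) (0 : E n)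
    rw [smul_zero, Real.norm_eq_abs] at h3
    rw [← h3, ← h2]
    simp

/-- If an integer plane is at integer distance `N` from the origin, then the functional that is
equal to `1` on it takes on the integer points of its span precisely the multiples of `1 / N`. -/
lemma latticeValues_eq_of_integerDistance {n : ℕ} {P : AffineSubspace ℝ (E n)} {p : E n}
    (hpP : p ∈ P) (hp : p ∈ integerPoints n) {N : ℝ} (hN : 0 < N) (hd : integerDistance P = N)
    {h : E n →ₗ[ℝ] ℝ} (hh : ∀ x, x ∈ P ↔ x ∈ Submodule.span ℝ (P : Set (E n)) ∧ h x = 1) :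
    latticeValues h (Submodule.span ℝ (P : Set (E n))) = AddSubgroup.zmultiples N⁻¹ := by
  set W := Submodule.span ℝ (P : Set (E n)) with hW
  set δ := Metric.infDist 0 (P : Set (E n)) with hδ
  set S := {r : ℝ | 0 < r ∧ ∃ x ∈ integerPoints n, x ∈ W ∧ r = Metric.infDist x (P : Set (E n))}
    with hS
  have hd' : δ / sInf S = N := hd
  have hpW : p ∈ W := Submodule.subset_span hpP
  have hp1 : h p = 1 := ((hh p).1 hpP).2
  have hδ0 : 0 < δ := by
    refine Metric.infDist_nonneg.lt_of_ne fun h0 => ?_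
    rw [← hδ] at h0
    rw [← h0, zero_div] at hd'
    exact hN.ne hd'
  -- Since `N > 0`, this also excludes the default values of `sInf` on the empty set and of division
  -- by zero.
  have hSpos : 0 < sInf S := by
    by_contra! hle
    have := div_nonpos_of_nonneg_of_nonpos hδ0.le hle
    linarith
  have hSinf : sInf S = δ * N⁻¹ := by
    rw [← hd']
    field_simp
  -- A positive value `g = h x` is realized as a distance by `p - x`, because `1 - h (p - x) = g`.
  have hmemS : ∀ g ∈ latticeValues h W, 0 < g → δ * g ∈ S := by
    rintro _ ⟨x, hx, hxW, rfl⟩ hg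
    refine ⟨by positivity, p - x, sub_mem_integerPoints hp hx, W.sub_mem hpW hxW, ?_⟩
    rw [infDist_eq_of_functional hh (W.sub_mem hpW hxW), map_sub, hp1,
      sub_sub_cancel, abs_of_pos hg, mul_comm]
  have hbdd : BddBelow S := ⟨0, fun r hr => hr.1.le⟩
  have hle : ∀ g ∈ latticeValues h W, 0 < g → N⁻¹ ≤ g := by
    intro g hg hg0
    have := csInf_le hbdd (hmemS g hg hg0)
    rw [hSinf] at this
    exact le_of_mul_le_mul_left this hδ0
  have hdisj : Disjoint (latticeValues h W : Set ℝ) (Ioo 0 N⁻¹) :=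
    Set.disjoint_left.2 fun g hg hg' => (hle g hg hg'.1).not_gt hg'.2
  have hbot : latticeValues h W ≠ ⊥ := by
    intro hbot
    have : (1 : ℝ) ∈ latticeValues h W := ⟨p, hp, hpW, hp1⟩
    rw [hbot, AddSubgroup.mem_bot] at this
    exact one_ne_zero this
  obtain ⟨b, hb⟩ := AddSubgroup.exists_isLeast_pos hbot (inv_pos.2 hN) hdisj
  -- The values have no element in `(0, N⁻¹)`, hence a least positive one `b`. It corresponds to the
  -- least distance, so the infimum is attained and `b = N⁻¹`.
  have hbS : IsLeast S (δ * b) := by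
    refine ⟨hmemS b hb.1.1 hb.1.2, ?_⟩
    rintro _ ⟨hr, x, hx, hxW, rfl⟩
    rw [infDist_eq_of_functional hh hxW, ← hδ, mul_comm |1 - h x|] at hr ⊢
    have hpx : h (p - x) ∈ latticeValues h W :=
      ⟨p - x, sub_mem_integerPoints hp hx, W.sub_mem hpW hxW, rfl⟩
    rw [map_sub, hp1] at hpx
    have habs : |1 - h x| ∈ latticeValues h W := by
      rcases abs_choice (1 - h x) with e | e <;> rw [e]
      · exact hpx
      · exact neg_mem hpx
    exact mul_le_mul_of_nonneg_left (hb.2 ⟨habs, pos_of_mul_pos_right hr hδ0.le⟩) hδ0.le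
  have hbN : b = N⁻¹ := by
    have := hbS.csInf_eq
    rw [hSinf] at this
    exact (mul_left_cancel₀ hδ0.ne' this).symm
  rw [AddSubgroup.cyclic_of_min hb, hbN, AddSubgroup.zmultiples_eq_closure]

lemma zero_notMem_of_integerDistance {n : ℕ} {P : AffineSubspace ℝ (E n)}
    (hd : integerDistance P ≠ 0) : (0 : E n) ∉ P := by
  intro h0
  exact hd (by rw [integerDistance, Metric.infDist_zero_of_mem h0, zero_div])

/-! ### Projective transformations in the chart -/

lemma chartPoint_castSucc {n : ℕ} (x : Fin n → ℝ) (j : Fin n) :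
    chartPoint x j.castSucc = x j := by
  simp [chartPoint]

lemma chartPoint_last {n : ℕ} (x : Fin n → ℝ) : chartPoint x (Fin.last n) = 1 := by
  simp [chartPoint]

/-- The denominator of the projective transformation defined by `A`. -/
def projDen {n : ℕ} (A : E n ≃ₗ[ℝ] E n) (u : Fin n → ℝ) : ℝ :=
  A (chartPoint u) (Fin.last n)

/-- The projective transformation defined by `A` in the affine coordinates of the chart. -/
def projMap {n : ℕ} (A : E n ≃ₗ[ℝ] E n) (u : Fin n → ℝ) : Fin n → ℝ :=
  fun j => A (chartPoint u) j.castSucc / projDen A u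

lemma map_chartPoint {n : ℕ} (A : E n ≃ₗ[ℝ] E n) {u : Fin n → ℝ} (hu : projDen A u ≠ 0) :
    A (chartPoint u) = projDen A u • chartPoint (projMap A u) := by
  ext j
  refine Fin.lastCases ?_ (fun j => ?_) j
  · simp [chartPoint_last, projDen]
  · simp only [PiLp.smul_apply, chartPoint_castSucc, smul_eq_mul, projMap]
    field_simp

lemma smul_map_symm_chartPoint {n : ℕ} (A : E n ≃ₗ[ℝ] E n) {u : Fin n → ℝ}
    (hu : projDen A u ≠ 0) :
    projDen A u • A.symm (chartPoint (projMap A u)) = chartPoint u := by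
  rw [← map_smul, ← map_chartPoint A hu, A.symm_apply_apply]

lemma projDen_symm {n : ℕ} (A : E n ≃ₗ[ℝ] E n) {u : Fin n → ℝ} (hu : projDen A u ≠ 0) :
    projDen A u * projDen A.symm (projMap A u) = 1 := by
  have h := congrArg (fun v : E n => v (Fin.last n)) (smul_map_symm_chartPoint A hu)
  simpa [chartPoint_last, projDen] using h

lemma projDen_symm_ne_zero {n : ℕ} (A : E n ≃ₗ[ℝ] E n) {u : Fin n → ℝ} (hu : projDen A u ≠ 0) :
    projDen A.symm (projMap A u) ≠ 0 :=
  right_ne_zero_of_mul_eq_one (projDen_symm A hu)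

lemma projMap_symm {n : ℕ} (A : E n ≃ₗ[ℝ] E n) {u : Fin n → ℝ} (hu : projDen A u ≠ 0) :
    projMap A.symm (projMap A u) = u := by
  funext j
  have h := congrArg (fun v : E n => v j.castSucc) (smul_map_symm_chartPoint A hu)
  simp only [PiLp.smul_apply, smul_eq_mul, chartPoint_castSucc] at h
  have h1 := projDen_symm A hu
  have h2 := projDen_symm_ne_zero A hu
  rw [projMap, div_eq_iff h2, ← h]
  linear_combination (A.symm (chartPoint (projMap A u)) j.castSucc) * (-h1)

lemma mk_chartPoint_projMap {n : ℕ} (A : E n ≃ₗ[ℝ] E n) {u : Fin n → ℝ} (hu : projDen A u ≠ 0) :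
    Projectivization.mk ℝ (chartPoint (projMap A u)) (chartPoint_ne_zero _)
      = (Projectivization.mk ℝ (chartPoint u) (chartPoint_ne_zero _)).map A.toLinearMap
        A.injective := by
  rw [Projectivization.map_mk, Projectivization.mk_eq_mk_iff']
  refine ⟨(projDen A u)⁻¹, ?_⟩
  change (projDen A u)⁻¹ • A (chartPoint u) = _
  rw [map_chartPoint A hu, inv_smul_smul₀ hu]

/-- The standard basis of the space of continued fractions. -/
abbrev stdBasis (n : ℕ) : Basis (Fin (n + 1)) ℝ (E n) :=
  (EuclideanSpace.basisFun (Fin (n + 1)) ℝ).toBasis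

lemma simplexVolume_eq {n : ℕ} (x : Fin (n + 1) → Fin n → ℝ) :
    simplexVolume x = (stdBasis n).det (fun i => chartPoint (x i)) / (n ! : ℝ) := by
  rw [simplexVolume, Basis.det_apply, ← Matrix.det_transpose]
  rfl

/-- The volume is a determinant of the lifted vertices up to a constant. Applying `A` multiplies it
by `det A`, and rescaling the vertices back to height one divides out the denominators. -/
lemma simplexVolume_projMap {n : ℕ} (A : E n ≃ₗ[ℝ] E n) {x : Fin (n + 1) → Fin n → ℝ}
    (hx : ∀ i, projDen A (x i) ≠ 0) :
    (∏ i, projDen A (x i)) * simplexVolume (fun i => projMap A (x i))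
      = LinearMap.det A.toLinearMap * simplexVolume x := by
  have h1 := (stdBasis n).det_comp A.toLinearMap (fun i => chartPoint (x i))
  have h2 := (stdBasis n).det.map_smul_univ (fun i => projDen A (x i))
    (fun i => chartPoint (projMap A (x i)))
  have h3 : (A.toLinearMap ∘ fun i => chartPoint (x i))
      = fun i => projDen A (x i) • chartPoint (projMap A (x i)) :=
    funext fun i => map_chartPoint A (hx i)
  rw [h3, h2, smul_eq_mul] at h1
  rw [simplexVolume_eq, simplexVolume_eq, ← mul_div_assoc, h1, mul_div_assoc]

lemma continuous_simplexVolume {n : ℕ} :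
    Continuous fun x : Fin (n + 1) → Fin n → ℝ => simplexVolume x := by
  unfold simplexVolume
  refine Continuous.div_const (Continuous.matrix_det ?_) _
  refine continuous_pi fun i => continuous_pi fun j => ?_
  refine Fin.lastCases ?_ (fun j => ?_) j
  · simpa using continuous_const
  · simpa using (continuous_apply_apply i j)

lemma det_linearEquiv_ne_zero {n : ℕ} (A : E n ≃ₗ[ℝ] E n) :
    LinearMap.det A.toLinearMap ≠ 0 :=
  (LinearEquiv.isUnit_det' A).ne_zero

lemma chart_projMap {n : ℕ} (A : E n ≃ₗ[ℝ] E n) {x y : ChartDomain n}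
    (hx : ∀ i, projDen A (x.1 i) ≠ 0) (hy : y.1 = fun i => projMap A (x.1 i)) :
    chart n y = mapFCF A (chart n x) := by
  refine Subtype.ext (funext fun i => ?_)
  have h : ∀ (v : Fin n → ℝ), v = projMap A (x.1 i) →
      Projectivization.mk ℝ (chartPoint v) (chartPoint_ne_zero v)
      = (Projectivization.mk ℝ (chartPoint (x.1 i)) (chartPoint_ne_zero _)).map A.toLinearMap
        A.injective := by
    rintro _ rfl
    exact mk_chartPoint_projMap A (hx i)
  exact h _ (congrFun hy i)

/-! ### The Möbius measure as an integral in coordinates -/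

/-- The coordinates of the framed continued fractions in `U` that meet the chart. -/
def chartSet {n : ℕ} (U : Set (FCF n)) : Set (Fin (n + 1) → Fin n → ℝ) :=
  Subtype.val '' (chart n ⁻¹' U)

lemma measurableSet_chartDomain {n : ℕ} :
    MeasurableSet {x : Fin (n + 1) → Fin n → ℝ | simplexVolume x ≠ 0} :=
  (isOpen_ne_fun continuous_simplexVolume continuous_const).measurableSet

lemma measurableSet_chartSet {n : ℕ} {U : Set (FCF n)} (hU : MeasurableSet U) :
    MeasurableSet (chartSet U) :=
  measurableSet_chartDomain.subtype_image (measurable_chart n hU)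

lemma framedMobiusMeasure_apply {n : ℕ} {U : Set (FCF n)} (hU : MeasurableSet U) :
    framedMobiusMeasure n U
      = ∫⁻ x in chartSet U, ENNReal.ofReal (1 / |simplexVolume x| ^ (n + 1)) := by
  rw [framedMobiusMeasure, Measure.map_apply (measurable_chart n) hU,
    withDensity_apply _ (measurable_chart n hU)]
  exact setLIntegral_subtype measurableSet_chartDomain (chart n ⁻¹' U)
    fun x => ENNReal.ofReal (1 / |simplexVolume x| ^ (n + 1))

/-- The part of the coordinate space on which the projective transformation is defined. -/
def regularSet {n : ℕ} (A : E n ≃ₗ[ℝ] E n) : Set (Fin (n + 1) → Fin n → ℝ) :=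
  {x | ∀ i, projDen A (x i) ≠ 0}

/-- The maps of `A` and `A.symm` are mutually inverse on their regular sets, which makes this the
domain identity for the change of variables. -/
lemma image_chartSet {n : ℕ} (A : E n ≃ₗ[ℝ] E n) (U : Set (FCF n)) :
    (fun (x : Fin (n + 1) → Fin n → ℝ) i => projMap A (x i)) ''
      (chartSet (mapFCF A ⁻¹' U) ∩ regularSet A) = chartSet U ∩ regularSet A.symm := by
  have hvol : ∀ (B : E n ≃ₗ[ℝ] E n) {x : Fin (n + 1) → Fin n → ℝ}, simplexVolume x ≠ 0 →
      x ∈ regularSet B → simplexVolume (fun i => projMap B (x i)) ≠ 0 := by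
    intro B x hx hreg
    refine right_ne_zero_of_mul (a := ∏ i, projDen B (x i)) ?_
    rw [simplexVolume_projMap B hreg]
    exact mul_ne_zero (det_linearEquiv_ne_zero B) hx
  ext y
  constructor
  · rintro ⟨_, ⟨⟨x, hxU, rfl⟩, hreg⟩, rfl⟩
    refine ⟨⟨⟨_, hvol A x.2 hreg⟩, ?_, rfl⟩, fun i => projDen_symm_ne_zero A (hreg i)⟩
    rw [mem_preimage, chart_projMap A (x := x) hreg rfl]
    exact hxU
  · rintro ⟨⟨x, hxU, rfl⟩, hreg⟩
    refine ⟨fun i => projMap A.symm (x.1 i), ⟨⟨⟨_, hvol A.symm x.2 hreg⟩, ?_, rfl⟩, fun i => ?_⟩,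
      funext fun i => projMap_symm A.symm (hreg i)⟩
    · rw [mem_preimage, chart_projMap A.symm (x := x) hreg rfl, mem_preimage]
      have h := mapFCF_symm_mapFCF A.symm (chart n x)
      rw [LinearEquiv.symm_symm] at h
      rw [h]
      exact hxU
    · exact projDen_symm_ne_zero A.symm (hreg i)

lemma injOn_projMap {n : ℕ} (A : E n ≃ₗ[ℝ] E n) :
    InjOn (fun (x : Fin (n + 1) → Fin n → ℝ) i => projMap A (x i)) (regularSet A) := by
  intro x hx y hy hxy
  funext i
  rw [← projMap_symm A (hx i), ← projMap_symm A (hy i)]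
  exact congrArg _ (congrFun hxy i)

/-! ### The derivative of a projective transformation of the plane -/

/-- The matrix of a linear automorphism in the standard basis. -/
def stdMatrix (A : E 2 ≃ₗ[ℝ] E 2) : Matrix (Fin 3) (Fin 3) ℝ :=
  LinearMap.toMatrix (stdBasis 2) (stdBasis 2) A.toLinearMap

lemma det_stdMatrix (A : E 2 ≃ₗ[ℝ] E 2) : (stdMatrix A).det = LinearMap.det A.toLinearMap :=
  LinearMap.det_toMatrix (stdBasis 2) A.toLinearMap

lemma map_chartPoint_apply (A : E 2 ≃ₗ[ℝ] E 2) (u : Fin 2 → ℝ) (j : Fin 3) :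
    A (chartPoint u) j = stdMatrix A j 0 * u 0 + stdMatrix A j 1 * u 1 + stdMatrix A j 2 := by
  have h := congrFun
    (LinearMap.toMatrix_mulVec_repr (stdBasis 2) (stdBasis 2) A.toLinearMap (chartPoint u)) j
  have h0 : chartPoint u 0 = u 0 := chartPoint_castSucc u 0
  have h1 : chartPoint u 1 = u 1 := chartPoint_castSucc u 1
  have h2 : chartPoint u 2 = 1 := chartPoint_last u
  exact h.symm.trans ((Fin.sum_univ_three fun k : Fin 3 => stdMatrix A j k * chartPoint u k).trans
    (by rw [h0, h1, h2, mul_one]))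

/-- The linear part of the `j`-th coordinate of the image of a point of the chart. -/
def coordLinear (A : E 2 ≃ₗ[ℝ] E 2) (j : Fin 3) : (Fin 2 → ℝ) →L[ℝ] ℝ :=
  stdMatrix A j 0 • ContinuousLinearMap.proj 0 + stdMatrix A j 1 • ContinuousLinearMap.proj 1

lemma hasFDerivAt_map_chartPoint (A : E 2 ≃ₗ[ℝ] E 2) (u : Fin 2 → ℝ) (j : Fin 3) :
    HasFDerivAt (fun u => A (chartPoint u) j) (coordLinear A j) u := by
  have h : (fun u => A (chartPoint u) j) = fun u => coordLinear A j u + stdMatrix A j 2 := by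
    funext u
    rw [map_chartPoint_apply]
    simp [coordLinear]
  rw [h]
  exact (coordLinear A j).hasFDerivAt.add_const _

/-- The derivative of a projective transformation of the plane. -/
def projDeriv (A : E 2 ≃ₗ[ℝ] E 2) (u : Fin 2 → ℝ) : (Fin 2 → ℝ) →L[ℝ] (Fin 2 → ℝ) :=
  ContinuousLinearMap.pi fun j => (projDen A u ^ 2)⁻¹ •
    (projDen A u • coordLinear A j.castSucc - A (chartPoint u) j.castSucc • coordLinear A 2)

lemma hasFDerivAt_projMap (A : E 2 ≃ₗ[ℝ] E 2) {u : Fin 2 → ℝ} (hu : projDen A u ≠ 0) :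
    HasFDerivAt (projMap A) (projDeriv A u) u := by
  refine hasFDerivAt_pi.2 fun j => ?_
  have hden : HasFDerivAt (fun u => (projDen A u)⁻¹) (-(projDen A u ^ 2)⁻¹ • coordLinear A 2) u :=
    (hasDerivAt_inv hu).comp_hasFDerivAt u (hasFDerivAt_map_chartPoint A u 2)
  refine ((hasFDerivAt_map_chartPoint A u j.castSucc).mul hden).congr_fderiv ?_
  ext v
  simp only [add_apply, smul_apply, sub_apply, smul_eq_mul]
  field_simp
  ring

/-- The exponent 3 of the denominator matches the exponent of the volume in the density; invariance
of the measure rests on this. -/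
lemma det_projDeriv (A : E 2 ≃ₗ[ℝ] E 2) {u : Fin 2 → ℝ} (hu : projDen A u ≠ 0) :
    (projDeriv A u).det = LinearMap.det A.toLinearMap / projDen A u ^ 3 := by
  rw [ContinuousLinearMap.det, ← LinearMap.det_toMatrix', Matrix.det_fin_two,
    ← det_stdMatrix, Matrix.det_fin_three]
  have hd : projDen A u
      = stdMatrix A 2 0 * u 0 + stdMatrix A 2 1 * u 1 + stdMatrix A 2 2 :=
    map_chartPoint_apply A u 2
  simp only [LinearMap.toMatrix'_apply, projDeriv, coordLinear]
  simp [map_chartPoint_apply]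
  field_simp
  rw [hd]
  ring

lemma exists_projDen_ne_zero (A : E 2 ≃ₗ[ℝ] E 2) : ∃ u, projDen A u ≠ 0 := by
  by_contra! h
  have hd : ∀ u : Fin 2 → ℝ,
      stdMatrix A 2 0 * u 0 + stdMatrix A 2 1 * u 1 + stdMatrix A 2 2 = 0 := fun u =>
    (map_chartPoint_apply A u 2).symm.trans (h u)
  have h0 := hd ![0, 0]
  have h1 := hd ![1, 0]
  have h2 := hd ![0, 1]
  simp only [Matrix.cons_val_zero, Matrix.cons_val_one, mul_zero, zero_add, mul_one, add_zero]
    at h0 h1 h2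
  rw [h0, add_zero] at h1 h2
  refine det_linearEquiv_ne_zero A ?_
  rw [← det_stdMatrix, Matrix.det_fin_three, h0, h1, h2]
  ring

/-- The denominator is an affine function that does not vanish identically, so its zero set is a
proper affine subspace. -/
lemma ae_projDen_ne_zero (A : E 2 ≃ₗ[ℝ] E 2) : ∀ᵐ u : Fin 2 → ℝ, projDen A u ≠ 0 := by
  have hd : ∀ u : Fin 2 → ℝ, projDen A u
      = stdMatrix A 2 0 * u 0 + stdMatrix A 2 1 * u 1 + stdMatrix A 2 2 := fun u =>
    map_chartPoint_apply A u 2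
  let S : AffineSubspace ℝ (Fin 2 → ℝ) :=
    { carrier := {u | projDen A u = 0}
      smul_vsub_vadd_mem' := by
        intro c p q r hp hq hr
        simp only [mem_ofPred_eq, hd, vsub_eq_sub, vadd_eq_add, Pi.add_apply, Pi.smul_apply,
          Pi.sub_apply, smul_eq_mul] at hp hq hr ⊢
        linear_combination c * hp - c * hq + hr }
  have hS : S ≠ ⊤ := by
    intro h
    obtain ⟨u, hu⟩ := exists_projDen_ne_zero A
    have : u ∈ S := h ▸ AffineSubspace.mem_top ℝ _ u
    exact hu this
  have h := Measure.addHaar_affineSubspace volume S hS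
  rw [ae_iff]
  simp only [ne_eq, not_not]
  exact h

lemma ae_mem_regularSet (A : E 2 ≃ₗ[ℝ] E 2) :
    ∀ᵐ x : Fin 3 → Fin 2 → ℝ, x ∈ regularSet A := by
  have h : ∀ i : Fin 3, ∀ᵐ x : Fin 3 → Fin 2 → ℝ, projDen A (x i) ≠ 0 := fun i =>
    (Measure.quasiMeasurePreserving_eval (fun _ : Fin 3 => (volume : Measure (Fin 2 → ℝ))) i).ae
      (ae_projDen_ne_zero A)
  exact ae_all_iff.2 h

lemma measurableSet_regularSet (A : E 2 ≃ₗ[ℝ] E 2) : MeasurableSet (regularSet A) := by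
  have hc : Continuous (projDen A) := continuous_iff_continuousAt.2 fun u =>
    (hasFDerivAt_map_chartPoint A u 2).continuousAt
  have : regularSet A = ⋂ i, {x : Fin 3 → Fin 2 → ℝ | projDen A (x i) ≠ 0} := by
    ext x
    simp [regularSet]
  rw [this]
  exact MeasurableSet.iInter fun i =>
    (isOpen_ne_fun (hc.comp (continuous_apply i)) continuous_const).measurableSet

/-! ### Invariance of the Möbius measure -/

/-- The Möbius measure of framed continued fractions is projectively invariant. -/
lemma map_mapFCF_framedMobiusMeasure (A : E 2 ≃ₗ[ℝ] E 2) :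
    Measure.map (mapFCF A) (framedMobiusMeasure 2) = framedMobiusMeasure 2 := by
  refine Measure.ext fun U hU => ?_
  have hU' : MeasurableSet (mapFCF A ⁻¹' U) := measurable_mapFCF A hU
  have hae : ∀ (B : E 2 ≃ₗ[ℝ] E 2) (V : Set (FCF 2)),
      (chartSet V ∩ regularSet B : Set _) =ᵐ[volume] chartSet V := fun B V =>
    inter_ae_eq_left_of_ae_eq_univ (eventuallyEq_univ.2 (ae_mem_regularSet B))
  have hmeas : MeasurableSet (chartSet (mapFCF A ⁻¹' U) ∩ regularSet A) :=
    (measurableSet_chartSet hU').inter (measurableSet_regularSet A)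
  rw [Measure.map_apply (measurable_mapFCF A) hU, framedMobiusMeasure_apply hU,
    framedMobiusMeasure_apply hU', ← setLIntegral_congr (hae A.symm U),
    ← setLIntegral_congr (hae A (mapFCF A ⁻¹' U)), ← image_chartSet A U,
    lintegral_image_eq_lintegral_abs_det_fderiv_mul volume hmeas
      (f' := fun x => ContinuousLinearMap.pi fun i =>
        (projDeriv A (x i)).comp (ContinuousLinearMap.proj i))
      (fun x hx => (hasFDerivAt_pi.2 fun i => HasFDerivAt.comp (g := projMap A) x
        (hasFDerivAt_projMap A (hx.2 i)) (hasFDerivAt_apply i x)).hasFDerivWithinAt)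
      ((injOn_projMap A).mono inter_subset_right)]
  refine setLIntegral_congr_fun hmeas fun x hx => ?_
  have hreg : ∀ i, projDen A (x i) ≠ 0 := hx.2
  have hvol : simplexVolume x ≠ 0 := by
    obtain ⟨y, -, rfl⟩ := hx.1
    exact y.2
  rw [← ENNReal.ofReal_mul (abs_nonneg _)]
  congr 1
  -- The map acts on each vertex separately, so its Jacobian is a product over the three vertices:
  -- `(det A) ^ 3 / (∏ projDen) ^ 3`. The cube of the volume changes by the same factor.
  rw [ContinuousLinearMap.det_pi]
  have hdet := det_linearEquiv_ne_zero A
  have hprod : ∏ i, projDen A (x i) ≠ 0 := Finset.prod_ne_zero_iff.2 fun i _ => hreg i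
  have h1 : simplexVolume (fun i => projMap A (x i))
      = LinearMap.det A.toLinearMap * simplexVolume x / ∏ i, projDen A (x i) := by
    rw [eq_div_iff hprod, mul_comm, simplexVolume_projMap A hreg]
  have h2 : ∏ i, (projDeriv A (x i)).det
      = LinearMap.det A.toLinearMap ^ 3 / (∏ i, projDen A (x i)) ^ 3 := by
    rw [Finset.prod_congr rfl fun i _ => det_projDeriv A (hreg i), Finset.prod_div_distrib,
      Finset.prod_pow]
    simp
  rw [h1, h2, abs_div, abs_div, abs_mul, abs_pow, abs_pow]
  have a1 := abs_ne_zero.2 hdet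
  have a2 := abs_ne_zero.2 hprod
  have a3 := abs_ne_zero.2 hvol
  simp only [Nat.reduceAdd] at a2 ⊢
  field_simp

/-- The Möbius measure is projectively invariant, also on nonmeasurable sets. -/
lemma mobiusMeasure_preimage_mapCF (A : E 2 ≃ₗ[ℝ] E 2) (S : Set (CF 2)) :
    mobiusMeasure 2 (mapCF A ⁻¹' S) = mobiusMeasure 2 S := by
  -- For a measurable equivalence the formula for the push-forward holds on arbitrary sets, so `S`
  -- need not be measurable.
  have h : Measure.map (mapCFEquiv A) (Measure.map (proj 2) (framedMobiusMeasure 2))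
      = Measure.map (proj 2) (framedMobiusMeasure 2) := by
    rw [Measure.map_map (mapCFEquiv A).measurable (measurable_proj 2)]
    conv_rhs => rw [← map_mapFCF_framedMobiusMeasure A,
      Measure.map_map (measurable_proj 2) (measurable_mapFCF A)]
    rfl
  simp only [mobiusMeasure, Measure.smul_apply]
  congr 1
  conv_rhs => rw [← h, (mapCFEquiv A).map_apply]
  rfl

/-! ### The dimension of a face at integer distance two -/

/-- The multiples of an integer vector that are integer vectors. -/
def integerMultiples {n : ℕ} (v : E n) : AddSubgroup ℝ where
  carrier := {t | t • v ∈ integerPoints n}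
  zero_mem' := fun _ => ⟨0, by simp⟩
  add_mem' := fun {a b} ha hb => by
    change (a + b) • v ∈ integerPoints n
    rw [add_smul]
    exact add_mem_integerPoints ha hb
  neg_mem' := fun {a} ha => by
    change (-a) • v ∈ integerPoints n
    simpa using zsmul_mem_integerPoints (-1) ha

/-- Integer vectors on a line through the origin are the multiples of a primitive one. -/
lemma exists_integerMultiples_eq {n : ℕ} {v : E n} (hv : v ∈ integerPoints n) (hv0 : v ≠ 0) :
    ∃ b : ℝ, 0 < b ∧ b ≤ 1 ∧ integerMultiples v = AddSubgroup.zmultiples b := by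
  have hvn : 0 < ‖v‖ := norm_pos_iff.2 hv0
  have h1 : (1 : ℝ) ∈ integerMultiples v := by
    change (1 : ℝ) • v ∈ integerPoints n
    rwa [one_smul]
  have hbot : integerMultiples v ≠ ⊥ := by
    intro hbot
    rw [hbot, AddSubgroup.mem_bot] at h1
    exact one_ne_zero h1
  have hdisj : Disjoint (integerMultiples v : Set ℝ) (Ioo 0 ‖v‖⁻¹) := by
    refine Set.disjoint_left.2 fun t ht ht' => ?_
    have h2 := one_le_norm_of_mem_integerPoints ht (smul_ne_zero ht'.1.ne' hv0)
    rw [norm_smul, Real.norm_of_nonneg ht'.1.le, ← div_le_iff₀ hvn, one_div] at h2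
    exact ht'.2.not_ge h2
  obtain ⟨b, hb⟩ := AddSubgroup.exists_isLeast_pos hbot (inv_pos.2 hvn) hdisj
  exact ⟨b, hb.1.2, hb.2 ⟨h1, one_pos⟩,
    (AddSubgroup.cyclic_of_min hb).trans (AddSubgroup.zmultiples_eq_closure b).symm⟩

/-- An integer point or segment at integer distance two contains an integer point divisible by
two. -/
lemma exists_two_smul_mem {n : ℕ} {s : Set (E n)} (hs : s ⊆ integerPoints n) (hne : s.Nonempty)
    (hd : integerDistance (affineSpan ℝ s) = 2) (hdim : finrank ℝ (affineSpan ℝ s).direction ≤ 1) :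
    ∃ m ∈ integerPoints n, (2 : ℝ) • m ∈ convexHull ℝ s := by
  obtain ⟨p, hp⟩ := hne
  have hpP : p ∈ affineSpan ℝ s := subset_affineSpan ℝ s hp
  obtain ⟨h, hh⟩ := exists_functional_eq_one ⟨p, hpP⟩
    (zero_notMem_of_integerDistance (by rw [hd]; norm_num))
  have hvals := latticeValues_eq_of_integerDistance hpP (hs hp) two_pos hd hh
  obtain ⟨w, hw, hwW, hw2⟩ : (2 : ℝ)⁻¹ ∈ latticeValues h _ :=
    hvals ▸ AddSubgroup.mem_zmultiples _
  have h2w : (2 : ℝ) • w ∈ affineSpan ℝ s :=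
    (hh _).2 ⟨Submodule.smul_mem _ _ hwW, by rw [map_smul, hw2]; norm_num⟩
  by_cases hq : ∃ q ∈ s, q ≠ p
  · obtain ⟨q, hq, hqp⟩ := hq
    have hv0 : q - p ≠ 0 := sub_ne_zero.2 hqp
    obtain ⟨b, hb0, hb1, hb⟩ :=
      exists_integerMultiples_eq (sub_mem_integerPoints (hs hq) (hs hp)) hv0
    have hqd : q - p ∈ (affineSpan ℝ s).direction :=
      AffineSubspace.vsub_mem_direction (subset_affineSpan ℝ s hq) hpP
    have hwd : (2 : ℝ) • w - p ∈ (affineSpan ℝ s).direction :=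
      AffineSubspace.vsub_mem_direction h2w hpP
    have hdim1 : finrank ℝ (affineSpan ℝ s).direction = 1 :=
      le_antisymm hdim (Submodule.one_le_finrank_iff.2 fun hbot => hv0 (by
        rwa [hbot, Submodule.mem_bot] at hqd))
    obtain ⟨t, ht⟩ := exists_smul_eq_of_finrank_eq_one hdim1
      (x := ⟨q - p, hqd⟩) (fun h0 => hv0 (congrArg Subtype.val h0)) ⟨_, hwd⟩
    have ht' : t • (q - p) = (2 : ℝ) • w - p := congrArg Subtype.val ht
    have htm : t ∈ integerMultiples (q - p) := by
      change t • (q - p) ∈ integerPoints n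
      rw [ht']
      exact sub_mem_integerPoints (two_smul_mem_integerPoints hw) (hs hp)
    have hbm : b • (q - p) ∈ integerPoints n := by
      have : b ∈ integerMultiples (q - p) := hb ▸ AddSubgroup.mem_zmultiples b
      exact this
    rw [hb] at htm
    obtain ⟨j, rfl⟩ := AddSubgroup.mem_zmultiples_iff.1 htm
    rw [zsmul_eq_mul] at ht'
    -- With `2w - p = j • b • (q - p)`, an even `j` makes `p` itself divisible by two. An odd `j`
    -- does so for the next integer point `p + b • (q - p)`, which is on the segment as `b ≤ 1`.
    rcases Int.even_or_odd' j with ⟨i, rfl | rfl⟩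
    · refine ⟨w - (i : ℝ) • b • (q - p),
        sub_mem_integerPoints hw (zsmul_mem_integerPoints i hbm), ?_⟩
      have e : (2 : ℝ) • (w - (i : ℝ) • b • (q - p)) = p := by
        push_cast at ht'
        rw [smul_sub, sub_eq_iff_eq_add.1 ht'.symm]
        module
      rw [e]
      exact subset_convexHull ℝ s hp
    · refine ⟨w - (i : ℝ) • b • (q - p),
        sub_mem_integerPoints hw (zsmul_mem_integerPoints i hbm), ?_⟩
      have e : (2 : ℝ) • (w - (i : ℝ) • b • (q - p)) = (1 - b) • p + b • q := by
        push_cast at ht'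
        rw [smul_sub, sub_eq_iff_eq_add.1 ht'.symm]
        module
      rw [e]
      exact convex_convexHull ℝ s (subset_convexHull ℝ s hp) (subset_convexHull ℝ s hq)
        (by linarith) hb0.le (by ring)
  · push Not at hq
    have hsp : s = {p} := Set.eq_singleton_iff_unique_mem.2 ⟨hp, hq⟩
    refine ⟨w, hw, ?_⟩
    rw [hsp, AffineSubspace.mem_affineSpan_singleton] at h2w
    rw [h2w]
    exact subset_convexHull ℝ s hp

/-! ### Characterization of the continued fractions with a given face -/

/-- The closed cone over `O` lies above the plane `h = 0` and meets `h = 1` in a set whose integer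
points span `F`. -/
def SpansSlice {n : ℕ} (F : Set (E n)) (h : E n →ₗ[ℝ] ℝ) (O : Set (E n)) : Prop :=
  (∀ x ∈ closure O, x ≠ 0 → 0 < h x) ∧
    convexHull ℝ ((closure O ∩ {x | h x = 1}) ∩ integerPoints n) = F

/-- Integrality is compared only on `h = 1`, since the linear map to be used need not preserve the
lattice off that plane. -/
lemma SpansSlice.image {n : ℕ} (A : E n ≃ₗ[ℝ] E n) {F O : Set (E n)} {h h' : E n →ₗ[ℝ] ℝ}
    (hA : ∀ x, h' (A x) = h x)
    (hZ : ∀ x, h x = 1 → (A x ∈ integerPoints n ↔ x ∈ integerPoints n))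
    (H : SpansSlice F h O) : SpansSlice (A '' F) h' (A '' O) := by
  obtain ⟨hpos, hF⟩ := H
  refine ⟨?_, ?_⟩
  · rw [closure_image_linearEquiv]
    rintro _ ⟨x, hx, rfl⟩ hx0
    rw [hA]
    exact hpos x hx (A.map_ne_zero_iff.1 hx0)
  · have e : closure (A '' O) ∩ {x | h' x = 1} ∩ integerPoints n
        = A.toLinearMap '' (closure O ∩ {x | h x = 1} ∩ integerPoints n) := by
      rw [closure_image_linearEquiv]
      ext y
      constructor
      · rintro ⟨⟨⟨x, hx, rfl⟩, hx1⟩, hxZ⟩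
        have hx1' : h x = 1 := (hA x).symm.trans hx1
        exact ⟨x, ⟨⟨hx, hx1'⟩, (hZ x hx1').1 hxZ⟩, rfl⟩
      · rintro ⟨x, ⟨⟨hx, hx1⟩, hxZ⟩, rfl⟩
        exact ⟨⟨⟨x, hx, rfl⟩, (hA x).trans hx1⟩, (hZ x hx1).2 hxZ⟩
    rw [e, ← LinearMap.image_convexHull, hF]
    rfl

lemma IsIntegerPolytope.isCompact {n : ℕ} {F : Set (E n)} (hF : IsIntegerPolytope F) :
    IsCompact F := by
  obtain ⟨s, -, rfl⟩ := hF
  exact (s.finite_toSet.isCompact_convexHull ℝ)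

lemma IsIntegerPolytope.convex {n : ℕ} {F : Set (E n)} (hF : IsIntegerPolytope F) :
    Convex ℝ F := by
  obtain ⟨s, -, rfl⟩ := hF
  exact convex_convexHull ℝ _

/-- This is a property of `F` alone: one continued fraction with the face `F` yields it for use with
every other orthant. -/
lemma two_smul_notMem_of_isFaceOfSomeCF {n : ℕ} (hn : 2 ≤ n) {F : Set (E n)}
    (hF : IsIntegerPolytope F) (hface : IsFaceOfSomeCF n F) {m : E n} (hm : m ∈ integerPoints n)
    (hm0 : m ≠ 0) : (2 : ℝ) • m ∉ F := by
  obtain ⟨c, S, ⟨l, -, O, hO, rfl⟩, k, ⟨H, hH, hHF⟩, -⟩ := hface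
  rw [hHF]
  exact hO.isPointedCone.two_smul_notMem_face hn hH (hHF ▸ hF.convex)
    (hHF ▸ hF.isCompact.isBounded) hm hm0

lemma finrank_direction_affineSpan_le {n : ℕ} {F : Set (E n)} (hface : IsFaceOfSomeCF n F) :
    finrank ℝ (affineSpan ℝ F).direction ≤ n := by
  obtain ⟨c, S, -, k, ⟨H, hH, hHF⟩, -⟩ := hface
  refine (Submodule.finrank_mono (AffineSubspace.direction_le ?_)).trans_eq hH
  refine affineSpan_le.2 ?_
  rw [hHF]
  exact inter_subset_left

/-- For the empty set `Metric.infDist` has the default value zero. -/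
lemma nonempty_of_integerDistance {n : ℕ} {F : Set (E n)}
    (hd : integerDistance (affineSpan ℝ F) ≠ 0) : F.Nonempty := by
  by_contra! h
  exact hd (by simp [integerDistance, h])

/-- The continued fractions with a given two-dimensional face whose plane is at integer distance
one or two. -/
lemma mem_CFWithFace_iff {F : Set (E 2)} (hF : IsIntegerPolytope F) (hne : F.Nonempty)
    (hface : IsFaceOfSomeCF 2 F) (hdim : finrank ℝ (affineSpan ℝ F).direction = 2)
    {h : E 2 →ₗ[ℝ] ℝ} (hh : ∀ x, x ∈ affineSpan ℝ F ↔ h x = 1)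
    (hvals : ∀ x ∈ integerPoints 2, ∃ k : ℤ, h x = k / 2) (c : CF 2) :
    c ∈ CFWithFace 2 F ↔ ∃ l O, proj 2 l = c ∧ IsOrthant l O ∧ SpansSlice F h O := by
  constructor
  · rintro ⟨S, ⟨l, hl, O, hO, rfl⟩, k, ⟨H, hH, hHF⟩, -⟩
    refine ⟨l, O, hl, hO, ?_⟩
    -- By dimension, the cutting plane `H` can only be the affine span of `F`.
    have hle : affineSpan ℝ F ≤ H := by
      refine affineSpan_le.2 ?_
      rw [hHF]
      exact inter_subset_left
    have hPH : affineSpan ℝ F = H := by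
      obtain ⟨x, hx⟩ := hne
      exact AffineSubspace.eq_of_direction_eq_of_nonempty_of_le
        (Submodule.eq_of_le_of_finrank_eq (AffineSubspace.direction_le hle) (hdim.trans hH.symm))
        ⟨x, subset_affineSpan ℝ F hx⟩ hle
    obtain ⟨s, hs, rfl⟩ := hF
    rw [hPH] at hh
    exact hO.isPointedCone.pos_and_convexHull_eq_of_face le_rfl hH hh hs
      (convexHull_nonempty_iff.1 hne) (s.finite_toSet.isCompact_convexHull ℝ).isBounded hHF
  · rintro ⟨l, O, hl, hO, hpos, hslice⟩
    -- The dimension and disc conditions concern only `F`, so they carry over from the given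
    -- continued fraction.
    obtain ⟨-, -, -, k, -, hk⟩ := id hface
    refine ⟨sail O, ⟨l, hl, O, hO, rfl⟩, k, ⟨affineSpan ℝ F, hdim, ?_⟩, hk⟩
    have hP : (affineSpan ℝ F : Set (E 2)) = {x | h x = 1} := Set.ext hh
    rw [hP]
    refine (hO.isPointedCone.inter_sail_eq hpos (ε := 1 / 2) (by norm_num) ?_ hslice hne
      hF.isCompact).symm
    intro x hxO hx hx0
    obtain ⟨k, hk⟩ := hvals x hx
    have hxpos := hpos x hxO hx0
    rw [hk] at hxpos
    have hk0 : 0 < k := by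
      by_contra! hle
      have : (k : ℝ) ≤ 0 := by exact_mod_cast hle
      linarith
    -- A point at height `1/2` would have its double in the slice, hence in `F`.
    have hk1 : k ≠ 1 := by
      rintro rfl
      refine two_smul_notMem_of_isFaceOfSomeCF le_rfl hF hface hx hx0 ?_
      rw [← hslice]
      refine subset_convexHull ℝ _ ⟨⟨hO.isPointedCone.smul_mem_closure two_pos hxO, ?_⟩,
        two_smul_mem_integerPoints hx⟩
      simp [hk]
    rcases (show k = 2 ∨ 3 ≤ k by omega) with rfl | hk3
    · left
      rw [hk]
      norm_num
    · right
      have : (3 : ℝ) ≤ k := by exact_mod_cast hk3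
      rw [hk]
      linarith

/-- The functional that defines the plane of a two-dimensional face, and its integer values. -/
lemma exists_functional_of_integerDistance {F : Set (E 2)} (hF : IsIntegerPolytope F)
    (hdim : finrank ℝ (affineSpan ℝ F).direction = 2) {N : ℝ} (hN : 0 < N)
    (hd : integerDistance (affineSpan ℝ F) = N) :
    ∃ h : E 2 →ₗ[ℝ] ℝ, (∀ x, x ∈ affineSpan ℝ F ↔ h x = 1) ∧
      ∀ x ∈ integerPoints 2, ∃ k : ℤ, h x = k / N := by
  have hne : F.Nonempty := nonempty_of_integerDistance (by rw [hd]; exact hN.ne')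
  have h0 : (0 : E 2) ∉ affineSpan ℝ F :=
    zero_notMem_of_integerDistance (by rw [hd]; exact hN.ne')
  obtain ⟨s, hs, rfl⟩ := hF
  obtain ⟨p, hp⟩ := convexHull_nonempty_iff.1 hne
  have hpP : p ∈ affineSpan ℝ (convexHull ℝ (s : Set (E 2))) :=
    subset_affineSpan ℝ _ (subset_convexHull ℝ _ hp)
  obtain ⟨f, a, hf⟩ := exists_functional_of_finrank_direction _ ⟨p, hpP⟩ hdim
  have ha : a ≠ 0 := by
    rintro rfl
    exact h0 ((hf 0).2 (map_zero f))
  have hh : ∀ x, x ∈ affineSpan ℝ (convexHull ℝ (s : Set (E 2))) ↔ (a⁻¹ • f) x = 1 := by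
    intro x
    rw [hf, LinearMap.smul_apply, smul_eq_mul, inv_mul_eq_one₀ ha, eq_comm]
  refine ⟨a⁻¹ • f, hh, fun x hx => ?_⟩
  set P := affineSpan ℝ (convexHull ℝ (s : Set (E 2))) with hP
  -- Adding a multiple of `p` moves any `x` into `P`, so the linear span is the whole space and
  -- every integer point counts.
  have hspan : ∀ x, x ∈ Submodule.span ℝ (P : Set (E 2)) := by
    intro x
    have h1 : x + (1 - (a⁻¹ • f) x) • p ∈ P := by
      rw [hh, map_add, map_smul, (hh p).1 hpP]
      simp
    have h2 := Submodule.sub_mem _ (Submodule.subset_span (R := ℝ) h1)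
      (Submodule.smul_mem _ (1 - (a⁻¹ • f) x) (Submodule.subset_span (R := ℝ) hpP))
    rwa [add_sub_cancel_right] at h2
  have hvals := latticeValues_eq_of_integerDistance hpP (hs hp) hN hd
    (h := a⁻¹ • f) fun x => by rw [hh, and_iff_right (hspan x)]
  have hmem : (a⁻¹ • f) x ∈ latticeValues (a⁻¹ • f) (Submodule.span ℝ (P : Set (E 2))) :=
    ⟨x, hx, hspan x, rfl⟩
  rw [hvals, AddSubgroup.mem_zmultiples_iff] at hmem
  obtain ⟨k, hk⟩ := hmem
  exact ⟨k, by rw [← hk, zsmul_eq_mul, div_eq_mul_inv]⟩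

/-! ### Linear extension from the plane, and the conclusion -/

/-- An affine automorphism that takes the plane `h = 1` to the plane `h' = 1` agrees on it with a
linear automorphism. -/
lemma exists_linearEquiv_extension {n : ℕ} (g : E n ≃ᵃ[ℝ] E n) {h h' : E n →ₗ[ℝ] ℝ} {p : E n}
    (hp : h p = 1) (hg : ∀ x, h x = 1 → h' (g x) = 1) :
    ∃ A : E n ≃ₗ[ℝ] E n, (∀ x, h' (A x) = h x) ∧ ∀ x, h x = 1 → A x = g x := by
  have hgx : ∀ x, g x = g.linear x + g 0 := fun x => by
    have := g.map_vadd 0 x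
    simpa using this
  -- Homogenization of `g x = g.linear x + g 0`: the constant term is multiplied by `h x`.
  let A₀ : E n →ₗ[ℝ] E n := g.linear.toLinearMap + h.smulRight (g 0)
  have hA₀ : ∀ x, A₀ x = g.linear x + h x • g 0 := fun x => rfl
  have hAg : ∀ x, h x = 1 → A₀ x = g x := fun x hx => by rw [hA₀, hx, one_smul, ← hgx]
  have hh : ∀ x, h' (A₀ x) = h x := by
    intro x
    have h1 : h (x + (1 - h x) • p) = 1 := by simp [hp]
    have h2 := hg _ h1
    rw [← hAg _ h1, map_add, map_smul, map_add, map_smul, hAg p hp, hg p hp, smul_eq_mul] at h2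
    linarith
  -- The kernel lies in `h = 0`, where `A₀` coincides with the invertible linear part of `g`.
  have hinj : Function.Injective A₀ := by
    rw [injective_iff_map_eq_zero]
    intro x hx
    have h1 : h x = 0 := by rw [← hh, hx, map_zero]
    rw [hA₀, h1, zero_smul, add_zero] at hx
    exact g.linear.map_eq_zero_iff.1 hx
  exact ⟨LinearEquiv.ofInjectiveEndo A₀ hinj, hh, hAg⟩

/-- Faces of the same integer-affine type at the integer distances one and two have the same relative
frequency. -/
theorem relativeFrequency_eq_of_integerDistance
    (F₁ F₂ : Set (E 2))
    (hF₁ : IsIntegerPolytope F₁) (hF₂ : IsIntegerPolytope F₂)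
    (hface₁ : IsFaceOfSomeCF 2 F₁) (hface₂ : IsFaceOfSomeCF 2 F₂)
    (htype : SameIntegerAffineType F₁ F₂)
    (hdist₁ : integerDistance (affineSpan ℝ F₁) = 1)
    (hdist₂ : integerDistance (affineSpan ℝ F₂) = 2) :
    relativeFrequency 2 F₁ = relativeFrequency 2 F₂ := by
  have hne₁ : F₁.Nonempty := nonempty_of_integerDistance (by rw [hdist₁]; norm_num)
  have hne₂ : F₂.Nonempty := nonempty_of_integerDistance (by rw [hdist₂]; norm_num)
  obtain ⟨g, hgZ, hgF⟩ := htype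
  -- A point or segment at distance two would contain twice an integer point. That point is nonzero
  -- because the affine hull misses the origin.
  have hdim₂ : finrank ℝ (affineSpan ℝ F₂).direction = 2 := by
    refine le_antisymm (finrank_direction_affineSpan_le hface₂) ?_
    by_contra! hlt
    obtain ⟨s, hs, hsF⟩ := id hF₂
    have hspan : affineSpan ℝ F₂ = affineSpan ℝ (s : Set (E 2)) := by
      rw [hsF, affineSpan_convexHull]
    rw [hspan] at hlt
    obtain ⟨m, hm, h2m⟩ := exists_two_smul_mem hs
      (convexHull_nonempty_iff.1 (hsF ▸ hne₂)) (hspan ▸ hdist₂) (Nat.le_of_lt_succ hlt)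
    rw [← hsF] at h2m
    refine two_smul_notMem_of_isFaceOfSomeCF le_rfl hF₂ hface₂ hm ?_ h2m
    rintro rfl
    rw [smul_zero] at h2m
    exact zero_notMem_of_integerDistance (by rw [hdist₂]; norm_num)
      (subset_affineSpan ℝ F₂ h2m)
  have hmap : (affineSpan ℝ F₁).map g.toAffineMap = affineSpan ℝ F₂ := by
    rw [AffineSubspace.map_span, ← hgF]
    rfl
  have hdim₁ : finrank ℝ (affineSpan ℝ F₁).direction = 2 := by
    rw [← hmap, AffineSubspace.map_direction] at hdim₂
    exact (LinearEquiv.finrank_map_eq g.linear _).symm.trans hdim₂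
  obtain ⟨h₁, hh₁, hv₁⟩ := exists_functional_of_integerDistance hF₁ hdim₁ one_pos hdist₁
  obtain ⟨h₂, hh₂, hv₂⟩ := exists_functional_of_integerDistance hF₂ hdim₂ two_pos hdist₂
  -- Integers are written as half-integers so that one criterion serves both distances.
  have hv₁' : ∀ x ∈ integerPoints 2, ∃ k : ℤ, h₁ x = k / 2 := fun x hx => by
    obtain ⟨k, hk⟩ := hv₁ x hx
    exact ⟨2 * k, by rw [hk]; push_cast; ring⟩
  obtain ⟨p, hp⟩ := hne₁
  obtain ⟨A, hA, hAg⟩ := exists_linearEquiv_extension g (h := h₁) (h' := h₂)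
    ((hh₁ p).1 (subset_affineSpan ℝ F₁ hp)) fun x hx => by
      rw [← hh₂, ← hmap]
      exact AffineSubspace.mem_map_of_mem g.toAffineMap ((hh₁ x).2 hx)
  have hgZ' : ∀ x, g x ∈ integerPoints 2 ↔ x ∈ integerPoints 2 := fun x => by
    rw [← hgZ, g.injective.mem_set_image, hgZ]
  have hAF : A '' F₁ = F₂ := by
    rw [← hgF]
    exact image_congr fun x hx => hAg x ((hh₁ x).1 (subset_affineSpan ℝ F₁ hx))
  have hAF' : A.symm '' F₂ = F₁ := by
    rw [← hAF, ← image_comp]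
    simp
  have hset : CFWithFace 2 F₁ = mapCF A ⁻¹' CFWithFace 2 F₂ := by
    ext c
    rw [mem_preimage, mem_CFWithFace_iff hF₁ ⟨p, hp⟩ hface₁ hdim₁ hh₁ hv₁',
      mem_CFWithFace_iff hF₂ hne₂ hface₂ hdim₂ hh₂ hv₂]
    constructor
    · rintro ⟨l, O, rfl, hO, hsl⟩
      refine ⟨mapFCF A l, A '' O, rfl, hO.image A, ?_⟩
      rw [← hAF]
      exact hsl.image A hA fun x hx => by rw [hAg x hx, hgZ']
    · rintro ⟨l, O, hl, hO, hsl⟩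
      refine ⟨mapFCF A.symm l, A.symm '' O, ?_, hO.image A.symm, ?_⟩
      · rw [← mapCF_proj, hl, mapCF_symm_mapCF]
      · rw [← hAF']
        refine hsl.image A.symm (fun x => by rw [← hA, A.apply_symm_apply]) fun x hx => ?_
        have hx1 : h₁ (A.symm x) = 1 := by rw [← hA, A.apply_symm_apply, hx]
        rw [← hgZ', ← hAg _ hx1, A.apply_symm_apply]
  rw [relativeFrequency, relativeFrequency, hset, mobiusMeasure_preimage_mapCF]

end KleinCF

end

theorem mainTheorem8 (F₁ F₂ : Set (KleinCF.E 2))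
    (hF₁ : KleinCF.IsIntegerPolytope F₁) (hF₂ : KleinCF.IsIntegerPolytope F₂)
    (hface₁ : KleinCF.IsFaceOfSomeCF 2 F₁) (hface₂ : KleinCF.IsFaceOfSomeCF 2 F₂)
    (htype : KleinCF.SameIntegerAffineType F₁ F₂)
    (hdist₁ : KleinCF.integerDistance (affineSpan ℝ F₁) = 1)
    (hdist₂ : KleinCF.integerDistance (affineSpan ℝ F₂) = 2) :
    KleinCF.relativeFrequency 2 F₁ = KleinCF.relativeFrequency 2 F₂ :=
  KleinCF.relativeFrequency_eq_of_integerDistance F₁ F₂ hF₁ hF₂ hface₁ hface₂ htype hdist₁ hdist₂
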